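/- **Setting.** Let $\mathcal X$ be a set of inputs with an arbitrary neighbouring relation $\sim$, let $\eta>0$ and $d\in\mathbb N$. Write $\mathrm{Lap}(b)$ for the distribution on $\mathbb R$ with density $\frac1{2b}e^{-|u|/b}$. *Noise.* A one-dimensional Laplace noise process is $Z_t=\sum_{n=0}^{P_t}\mathrm{Lap}(\mathcal T_n)$, $t\ge\eta$, where $(P_t)_{t\ge\eta}$ is an inhomogeneous Poisson process with $P_\eta=0$ and intensity $\lambda(t)=2/t$, $\mathcal T_0=\eta$, $\mathcal T_n=\inf\{t\ge\eta:P_t\ge n\}$ is its $n$-th jump time, and $\mathrm{Lap}(\mathcal T_n)$ stands for $\mathcal T_n\xi_n$ with $(\xi_n)_{n\ge0}$ i.i.d. $\mathrm{Lap}(1)$, independent of $(P_t)_{t\ge\eta}$. Let $(Z_t)_{t\ge\eta}$ be the $d$-dimensional Laplace noise process: its coordinates are independent one-dimensional Laplace noise processes. *Mechanism.* Time functions are measurable functions $T_n:(\mathbb R^d)^{n-1}\to[\eta,\infty)$, $n\ge1$, with $T_{n+1}(\beta_{1:n})\le T_n(\beta_{1:n-1})$ for all $n\ge 1$ and $\beta_{1:n}\in(\mathbb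 R^d)^n$. For $f:\mathcal X\to\mathbb R^d$, the Laplace noise reduction mechanism is $\mathrm{LNR}(x)=(\mathrm{LNR}_n(x))_{n\ge1}$, defined recursively by $$\mathrm{LNR}_n(x)=f(x)+Z_{T_n(x)},\qquad T_n(x):=T_n(\mathrm{LNR}_1(x),\dots,\mathrm{LNR}_{n-1}(x)).$$ *Stopping.* A stopping function is a measurable $N:(\mathbb R^d)^{\infty}\to\{1,2,\dots\}$ such that for every $x$, $N(x):=N(\mathrm{LNR}(x))$ is a stopping time with respect to the filtration $\sigma(\mathrm{LNR}_i(x):i\le n)$, $n\ge1$. The algorithm $\mathrm{LNR}_{1:N(\cdot)}(\cdot)$ maps $x$ to the finite sequence $(\mathrm{LNR}_1(x),\dots,\mathrm{LNR}_{N(x)}(x))$. *Ex-post privacy.* For an algorithm $A$ with values in $\mathcal Y$ and $x,x'\in\mathcal X$, the privacy loss is $\mathcal L(x,x')=\log\frac{p^{x}(A(x))}{p^{x'}(A(x))}$ (equal to $+\infty$ if the denominator vanishes), where $p^x,p^{x'}$ are the densities of the laws of $A(x),A(x')$ with respect to a common dominating measure. For $\mathcal E:\mathcal Y\to\mathbb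 R_{\ge0}$, $A$ is $\mathcal E$-ex-post private if $\mathbb P\big(\mathcal L(x,x')>\mathcal E(A(x))\big)=0$ for all $x\sim x'$. **Proposition 4.1.** Suppose $f$ has finite $\ell_1$-sensitivity $\Delta_1=\sup_{x\sim x'}\|f(x)-f(x')\|_1$, let $(T_n)_{n\ge1}$ be time functions and $\mathrm{LNR}$ the associated Laplace noise reduction mechanism. Then for every stopping function $N$, the algorithm $\mathrm{LNR}_{1:N(\cdot)}(\cdot)$ is $\Delta_1/T_{N(\cdot)}(\cdot)$-ex-post private; that is, it is ex-post private with $\mathcal E(y_1,\dots,y_n)=\Delta_1/T_n(y_1,\dots,y_{n-1})$. -/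

import Mathlib

open MeasureTheory ProbabilityTheory
open scoped NNReal ENNReal

namespace NoiseReduction

/-! ### Privacy -/

section Privacy

variable {Ω 𝒳 𝒴 : Type*} [MeasurableSpace Ω] [MeasurableSpace 𝒴]

/-- The privacy loss function `log (p y / q y)` of two finite measures `μ`, `ν` (the laws of the
outputs of an algorithm on two inputs), where `p` and `q` are the densities of `μ` and `ν` with
respect to the common dominating measure `μ + ν`. Up to a `μ`-null set, the ratio does not depend
on the choice of the dominating measure or of the versions of the densities. The value is `⊤`
where `q` vanishes and `p` does not. -/
noncomputable def privacyLoss (μ ν : Measure 𝒴) (y : 𝒴) : EReal :=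
  ENNReal.log (μ.rnDeriv (μ + ν) y / ν.rnDeriv (μ + ν) y)

/-- A randomized algorithm is a family `A x : Ω → 𝒴` of random variables on a probability space
`(Ω, P)`, indexed by the input `x`. It is `(E, δ)`-ex-post private, for the neighbouring relation
`Adj`, if for all neighbours `x`, `x'` the privacy loss between `A x` and `A x'`, evaluated at the
random output `A x`, exceeds `E (A x)` with probability at most `δ`. -/
def IsExPostPrivate (P : Measure Ω) (Adj : 𝒳 → 𝒳 → Prop) (A : 𝒳 → Ω → 𝒴)
    (E : 𝒴 → ℝ≥0) (δ : ℝ≥0∞) : Prop :=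
  (∀ x, AEMeasurable (A x) P) ∧
  ∀ x x', Adj x x' →
    P {ω | ((E (A x ω) : ℝ) : EReal) < privacyLoss (P.map (A x)) (P.map (A x')) (A x ω)} ≤ δ

/-- The `ℓ¹`-sensitivity `sup_{x ∼ x'} ‖f x - f x'‖₁`. -/
noncomputable def l1Sensitivity {d : ℕ} (Adj : 𝒳 → 𝒳 → Prop) (f : 𝒳 → Fin d → ℝ) : ℝ≥0∞ :=
  ⨆ (x : 𝒳) (x' : 𝒳) (_ : Adj x x'), ENNReal.ofReal (∑ i, |f x i - f x' i|)

/-- A stopping function for `M : 𝒳 → 𝒴^∞`: a (measurable) function `N` of the output sequence such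
that, for every input `x`, the random index `N (M x)` is a stopping time for the filtration
`σ(M_i(x) : i ≤ n)`. Indices start at `0`. -/
def IsStoppingFunction (M : 𝒳 → Ω → ℕ → 𝒴) (N : (ℕ → 𝒴) → ℕ) : Prop :=
  Measurable N ∧
  ∀ (x : 𝒳) (n : ℕ),
    MeasurableSet[⨆ i ≤ n, MeasurableSpace.comap (fun ω => M x ω i) inferInstance]
      {ω | N (M x ω) ≤ n}

/-- The algorithm that runs `M` and releases the iterates up to and including the one with index
`N (M x)`. Its output is a finite nonempty sequence; `⟨n, y⟩` consists of the iterates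
`y 0, …, y n`. -/
def stopped (M : 𝒳 → Ω → ℕ → 𝒴) (N : (ℕ → 𝒴) → ℕ) :
    𝒳 → Ω → (Σ n : ℕ, Fin (n + 1) → 𝒴) :=
  fun x ω => ⟨N (M x ω), fun j => M x ω j⟩

end Privacy

/-! ### The Laplace noise process -/

section Noise

variable {Ω : Type*} [MeasurableSpace Ω]

/-- The centred Laplace distribution on `ℝ` with scale `b > 0`. -/
noncomputable def laplaceMeasure (b : ℝ) : Measure ℝ :=
  volume.withDensity fun x => ENNReal.ofReal (1 / (2 * b) * Real.exp (-|x| / b))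

/-- `N` is an inhomogeneous Poisson process on `[η, ∞)` with intensity function `lam`: it starts at
`0`, its paths are nondecreasing and right-continuous, its increments are independent, and
`N t - N s` has the Poisson distribution with mean `∫ u in s..t, lam u`. -/
structure IsPoissonProcess (P : Measure Ω) (η : ℝ≥0) (lam : ℝ → ℝ)
    (N : Set.Ici η → Ω → ℕ) : Prop where
  measurable : ∀ t, Measurable (N t)
  start : ∀ ω, N ⟨η, le_refl η⟩ ω = 0
  monotone : ∀ ω, Monotone fun t => N t ω
  right_continuous : ∀ ω t, ContinuousWithinAt (fun s => N s ω) (Set.Ici t) t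
  indep_increments : HasIndepIncrements N P
  law_increments : ∀ s t : Set.Ici η, s ≤ t →
    HasLaw (fun ω => N t ω - N s ω)
      (poissonMeasure (∫ u in ((s : ℝ≥0) : ℝ)..((t : ℝ≥0) : ℝ), lam u).toNNReal) P

/-- The time `inf {t ≥ η | n ≤ p t}` of the `n`-th jump of a counting path `p`; for `n = 0` it
is `η`. -/
noncomputable def jumpTime {η : ℝ≥0} (p : Set.Ici η → ℕ) (n : ℕ) : ℝ≥0 :=
  sInf {t : ℝ≥0 | ∃ h : η ≤ t, n ≤ p ⟨t, h⟩}

/-- A one-dimensional Laplace noise process `Z_t = ∑_{n=0}^{N_t} Lap(τ_n)`, `t ≥ η`, where `N` is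
a Poisson process on `[η, ∞)` with intensity `2 / t`, `τ_0 = η`, and `τ_n` is its `n`-th jump time.
The summand `Lap(τ_n)` is `τ_n * ξ_n`, where the `ξ_n` are i.i.d. Laplace variables of scale `1`,
independent of the process `N`. -/
def IsLaplaceNoise (P : Measure Ω) (η : ℝ≥0) (Z : Set.Ici η → Ω → ℝ) : Prop :=
  ∃ (N : Set.Ici η → Ω → ℕ) (ξ : ℕ → Ω → ℝ),
    IsPoissonProcess P η (fun u => 2 / u) N ∧
    (∀ n, Measurable (ξ n)) ∧
    (∀ n, HasLaw (ξ n) (laplaceMeasure 1) P) ∧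
    iIndepFun ξ P ∧
    IndepFun (fun ω t => N t ω) (fun ω n => ξ n ω) P ∧
    ∀ t ω, Z t ω =
      ∑ n ∈ Finset.range (N t ω + 1), (jumpTime (fun s => N s ω) n : ℝ) * ξ n ω

/-- A `d`-dimensional Laplace noise process: its coordinates are independent one-dimensional
Laplace noise processes. -/
def IsLaplaceNoiseProcess {d : ℕ} (P : Measure Ω) (η : ℝ≥0)
    (Z : Set.Ici η → Ω → Fin d → ℝ) : Prop :=
  (∀ i, IsLaplaceNoise P η fun t ω => Z t ω i) ∧
  iIndepFun (fun (i : Fin d) (ω : Ω) (t : Set.Ici η) => Z t ω i) P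

end Noise

/-! ### The Laplace noise reduction mechanism -/

/-- A sequence of time functions with values in `[η, ∞)`. The function `T n` chooses the time of
the iterate with index `n` (indices start at `0`) from the `n` previous iterates, and the times
never increase. -/
structure IsTimeFunctions {d : ℕ} {η : ℝ≥0} (T : (n : ℕ) → (Fin n → Fin d → ℝ) → Set.Ici η) :
    Prop where
  measurable : ∀ n, Measurable (T n)
  antitone : ∀ (n : ℕ) (β : Fin (n + 1) → Fin d → ℝ), T (n + 1) β ≤ T n fun j => β j.castSucc

/-- The iterates `y_n = c + z (T n (y_0, …, y_{n-1}))` along a noise path `z`. -/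
def lnrPath {d : ℕ} {η : ℝ≥0} (T : (n : ℕ) → (Fin n → Fin d → ℝ) → Set.Ici η)
    (c : Fin d → ℝ) (z : Set.Ici η → Fin d → ℝ) (n : ℕ) : Fin d → ℝ :=
  c + z (T n fun j => lnrPath T c z j)
termination_by n
decreasing_by exact j.isLt

/-- The Laplace noise reduction mechanism associated with `f`, the time functions `T` and the
noise process `Z`. -/
def LNR {𝒳 Ω : Type*} {d : ℕ} {η : ℝ≥0} (f : 𝒳 → Fin d → ℝ)
    (T : (n : ℕ) → (Fin n → Fin d → ℝ) → Set.Ici η) (Z : Set.Ici η → Ω → Fin d → ℝ) :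
    𝒳 → Ω → ℕ → Fin d → ℝ :=
  fun x ω n => lnrPath T (f x) (fun t => Z t ω) n

/-- The function `Δ / T_N` of the released sequence: for an output `y_0, …, y_n` it is
`Δ / T n (y_0, …, y_{n-1})`. -/
noncomputable def timeRatio {d : ℕ} {η : ℝ≥0} (Δ : ℝ≥0)
    (T : (n : ℕ) → (Fin n → Fin d → ℝ) → Set.Ici η)
    (y : Σ n : ℕ, Fin (n + 1) → Fin d → ℝ) : ℝ≥0 :=
  Δ / (T y.1 fun j => y.2 j.castSucc : Set.Ici η)

end NoiseReduction

open NoiseReduction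

/-! The noise process is a Markov chain when read backwards in time. Its value at time `t` has law
Lap(`t`), and its increments after `t` are independent of that value. The time functions never
increase, so the first iterates up to index `n` are determined by the shifted path `f x + Z` on `[t,
∞)`, where `t` is the time of iterate `n`. This path consists of the vector `f x + Z t` and of later
increments which do not involve `f x`. Replacing `f x` by `f x'` therefore changes only the centre
of a product Laplace law of scale `t`, which costs a factor at most `exp (‖f x - f x'‖₁ / t)`. Later
iterates refine earlier ones instead of adding to the privacy loss.

Three points need work.

Law of the noise (`IsLaplaceNoise.integral_exp_sum_pathIncr`). Jump times are rounded up to a fine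
subdivision, so that each cell contributes a compound Poisson sum of constant scale. In the limit,
the increment from `s` to `t` has characteristic function `exp (∫ r in s..t, 2 / r * ((1 + (u * r) ^
2)⁻¹ - 1)) = (1 + (u * s) ^ 2) / (1 + (u * t) ^ 2)`, increments over disjoint intervals are
independent, and the quotients telescope to Lap(`t`).

Adaptive times (`lintegral_lnrPath_roundTime_le`, `measure_lnrPath_le`). For times in a finite grid,
the comparison is made separately on each event that the current time is a given grid point. General
times are rounded up to finer and finer grids. The paths are locally constant to the right, so for
every outcome the iterates eventually stop changing.

Stopping (`map_stopped_le`). The comparison is applied on each event `N = n`. That event is a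
condition on the first iterates, but one that depends on the input; absolute continuity of the laws
of the full sequences carries the condition for `x` over to `x'`. `privacyLoss_ae_le` then turns the
inequality between measures into a bound on the loss. -/

namespace NoiseReduction

/-! ### Laplace laws: characteristic function and cost of a translation -/

section Laplace

-- Splitting at `0` leaves two integrals of complex exponentials.
open Complex in
lemma charFun_laplaceMeasure {b : ℝ} (hb : 0 < b) (u : ℝ) :
    charFun (laplaceMeasure b) u = ((1 + (u * b) ^ 2)⁻¹ : ℝ) := by
  have hdens : Measurable fun x : ℝ => ENNReal.ofReal (1 / (2 * b) * Real.exp (-|x| / b)) := by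
    fun_prop
  rw [charFun_apply_real, laplaceMeasure,
    integral_withDensity_eq_integral_toReal_smul hdens (by simp)]
  have hnn : ∀ x : ℝ, 0 ≤ 1 / (2 * b) * Real.exp (-|x| / b) := fun x => by positivity
  simp_rw [ENNReal.toReal_ofReal (hnn _)]
  have hre1 : 0 < ((1 / b : ℝ) + u * I : ℂ).re := by simp [hb]
  have hre2 : ((-(1 / b) : ℝ) + u * I : ℂ).re < 0 := by simp [hb]
  have e1 : Set.EqOn (fun x : ℝ => (1 / (2 * b) * Real.exp (-|x| / b)) • cexp (u * x * I))
      (fun x : ℝ => (1 / (2 * b) : ℂ) * cexp (((1 / b : ℝ) + u * I : ℂ) * x)) (Set.Iic 0) := by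
    intro x hx
    simp only [abs_of_nonpos (Set.mem_Iic.1 hx), real_smul]
    push_cast
    rw [mul_assoc, ← Complex.exp_add]
    congr 2
    field_simp
  have e2 : Set.EqOn (fun x : ℝ => (1 / (2 * b) * Real.exp (-|x| / b)) • cexp (u * x * I))
      (fun x : ℝ => (1 / (2 * b) : ℂ) * cexp (((-(1 / b) : ℝ) + u * I : ℂ) * x)) (Set.Ioi 0) := by
    intro x hx
    simp only [abs_of_pos (Set.mem_Ioi.1 hx), real_smul]
    push_cast
    rw [mul_assoc, ← Complex.exp_add]
    congr 2
    field_simp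
  have i1 := (integrableOn_exp_mul_complex_Iic hre1 0).const_mul (1 / (2 * b) : ℂ)
  have i2 := (integrableOn_exp_mul_complex_Ioi hre2 0).const_mul (1 / (2 * b) : ℂ)
  rw [← intervalIntegral.integral_Iic_add_Ioi (b := 0)
      ((integrableOn_congr_fun e1 measurableSet_Iic).2 i1)
      ((integrableOn_congr_fun e2 measurableSet_Ioi).2 i2),
    setIntegral_congr_fun measurableSet_Iic e1, setIntegral_congr_fun measurableSet_Ioi e2,
    integral_const_mul, integral_const_mul, integral_exp_mul_complex_Iic hre1,
    integral_exp_mul_complex_Ioi hre2]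
  have hb' : (b : ℂ) ≠ 0 := by exact_mod_cast hb.ne'
  have h1 : ((1 / b : ℝ) + u * I : ℂ) ≠ 0 := fun h => by rw [h] at hre1; simp at hre1
  have h2 : ((-(1 / b) : ℝ) + u * I : ℂ) ≠ 0 := fun h => by rw [h] at hre2; simp at hre2
  have h3 : (1 + (u * b) ^ 2 : ℂ) ≠ 0 := by
    have : (1 + (u * b) ^ 2 : ℝ) ≠ 0 := by positivity
    exact_mod_cast this
  push_cast at h1 h2 ⊢
  have g1 : (1 / b + u * I : ℂ) = (1 + u * b * I) / b := by field_simp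
  have g2 : (-(1 / b) + u * I : ℂ) = (-1 + u * b * I) / b := by field_simp
  rw [g1] at h1 ⊢
  rw [g2] at h2 ⊢
  -- In terms of `w = u * b * I` alone, the goal is a rational identity, from partial fractions of
  -- `1 / (1 - w ^ 2)`.
  have key : ((u : ℂ) * b) ^ 2 = -(u * b * I) ^ 2 := by linear_combination (u * b : ℂ) ^ 2 * I_sq
  rw [key] at h3 ⊢
  generalize (u * b * I : ℂ) = w at *
  have h1' : 1 + w ≠ 0 := fun h => h1 (by simp [h])
  have h2' : -1 + w ≠ 0 := fun h => h2 (by simp [h])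
  simp only [mul_zero, Complex.exp_zero]
  field_simp
  ring

instance isProbabilityMeasure_laplaceMeasure {b : ℝ} [hb : Fact (0 < b)] :
    IsProbabilityMeasure (laplaceMeasure b) := by
  have h := charFun_laplaceMeasure hb.out 0
  rw [charFun_zero] at h
  have h' : (laplaceMeasure b).real Set.univ = 1 := by
    have : (((laplaceMeasure b).real Set.univ : ℝ) : ℂ) = (1 : ℝ) := by
      rw [h]; simp
    exact_mod_cast this
  refine ⟨?_⟩
  rw [measureReal_def, ENNReal.toReal_eq_one_iff] at h'
  exact h'

/-- By the triangle inequality the two densities have ratio at most `exp (|c - c'| / b)` pointwise.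
This is the only source of privacy loss. -/
lemma map_const_add_laplaceMeasure_le {b : ℝ} (hb : 0 < b) (c c' : ℝ) :
    (laplaceMeasure b).map (c + ·) ≤
      ENNReal.ofReal (Real.exp (|c - c'| / b)) • (laplaceMeasure b).map (c' + ·) := by
  have hdens : Measurable fun x : ℝ => ENNReal.ofReal (1 / (2 * b) * Real.exp (-|x| / b)) := by
    fun_prop
  have key : ∀ (c : ℝ) (A : Set ℝ), MeasurableSet A → (laplaceMeasure b).map (c + ·) A =
      ∫⁻ y in A, ENNReal.ofReal (1 / (2 * b) * Real.exp (-|y - c| / b)) := by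
    intro c A hA
    have hp : MeasurableSet ((c + ·) ⁻¹' A) := (measurable_const_add c) hA
    rw [Measure.map_apply (measurable_const_add c) hA, laplaceMeasure, withDensity_apply _ hp,
      ← lintegral_indicator hp, ← lintegral_indicator hA, ← lintegral_add_left_eq_self (A.indicator _) c]
    congr 1 with x
    simp only [Set.indicator, add_sub_cancel_left]
    rfl
  refine Measure.le_iff.2 fun A hA => ?_
  rw [Measure.smul_apply, key c A hA, key c' A hA, smul_eq_mul,
    ← lintegral_const_mul _ (by fun_prop)]
  refine lintegral_mono fun y => ?_
  rw [← ENNReal.ofReal_mul (by positivity)]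
  refine ENNReal.ofReal_le_ofReal ?_
  rw [mul_left_comm, ← Real.exp_add]
  gcongr
  rw [← add_div]
  gcongr
  have := abs_sub_le y c c'
  linarith [abs_sub_comm y c]

end Laplace

/-! ### Riemann sums for the exponent of the noise increments -/

section RiemannSum

open Filter Topology

/-- Bernoulli's inequality, for exponents in `[0, 1]`, in logarithmic form. -/
lemma mul_log_le_log_one_add_sq {u x y : ℝ} (hx : 0 < x) (hy : 0 < y) :
    2 * (Real.log y - Real.log x) * (1 - (1 + (u * x) ^ 2)⁻¹) ≤
      Real.log (1 + (u * y) ^ 2) - Real.log (1 + (u * x) ^ 2) := by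
  set p := 1 - (1 + (u * x) ^ 2)⁻¹ with hp
  have hpos : 0 < 1 + (u * x) ^ 2 := by positivity
  have hpos' : 0 < 1 + (u * y) ^ 2 := by positivity
  have hp' : p = (u * x) ^ 2 / (1 + (u * x) ^ 2) := by rw [hp]; field_simp; ring
  have hp0 : 0 ≤ p := by rw [hp']; positivity
  have hp1 : p ≤ 1 := by rw [hp]; linarith [inv_pos.2 hpos]
  have hw : 0 < (y / x) ^ 2 := by positivity
  -- `w ^ p ≤ 1 + p * (w - 1)` for `w = (y / x) ^ 2`; with this `p` the right side is exactly the
  -- quotient whose logarithm is wanted.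
  have h := rpow_one_add_le_one_add_mul_self (s := (y / x) ^ 2 - 1) (by linarith) hp0 hp1
  have e : 1 + p * ((y / x) ^ 2 - 1) = (1 + (u * y) ^ 2) / (1 + (u * x) ^ 2) := by
    rw [hp']; field_simp; ring
  rw [e, add_sub_cancel] at h
  have h2 := Real.log_le_log (by positivity) h
  rw [Real.log_rpow hw, Real.log_pow, Real.log_div hy.ne' hx.ne',
    Real.log_div hpos'.ne' hpos.ne'] at h2
  push_cast at h2
  linarith

/-- The left-hand sides are Riemann sums for `∫ r in s..t, 2 / r * ((1 + (u * r) ^ 2)⁻¹ - 1)`. -/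
lemma tendsto_sum_log_mul {s t : ℝ} (hs : 0 < s) (hst : s ≤ t) (u : ℝ) :
    Tendsto (fun m : ℕ => ∑ r ∈ Finset.range m,
        2 * (Real.log (s + (r + 1 : ℕ) * ((t - s) / m)) - Real.log (s + r * ((t - s) / m))) *
          ((1 + (u * (s + (r + 1 : ℕ) * ((t - s) / m))) ^ 2)⁻¹ - 1)) atTop
      (𝓝 (Real.log (1 + (u * s) ^ 2) - Real.log (1 + (u * t) ^ 2))) := by
  set L : ℝ → ℝ := fun x => Real.log (1 + (u * x) ^ 2) with hL
  set q : ℝ → ℝ := fun x => 1 - (1 + (u * x) ^ 2)⁻¹ with hq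
  have hst' : 0 ≤ t - s := by linarith
  have hq0 : ∀ x, 0 ≤ q x := fun x => by
    have : (1 + (u * x) ^ 2)⁻¹ ≤ 1 := inv_le_one_of_one_le₀ (by nlinarith [sq_nonneg (u * x)])
    simp only [hq]; linarith
  have hq1 : ∀ x, q x ≤ 1 := fun x => by
    have : 0 < (1 + (u * x) ^ 2)⁻¹ := by positivity
    simp only [hq]; linarith
  have hqm : ∀ x y, 0 < x → x ≤ y → q x ≤ q y := fun x y hx hxy => by
    have : (1 + (u * y) ^ 2)⁻¹ ≤ (1 + (u * x) ^ 2)⁻¹ := by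
      apply inv_anti₀ (by positivity)
      rw [mul_pow, mul_pow]; gcongr
    simp only [hq]; linarith
  have main : ∀ m : ℕ, 0 < m → |(∑ r ∈ Finset.range m,
        2 * (Real.log (s + (r + 1 : ℕ) * ((t - s) / m)) - Real.log (s + r * ((t - s) / m))) *
          ((1 + (u * (s + (r + 1 : ℕ) * ((t - s) / m))) ^ 2)⁻¹ - 1)) - (L s - L t)| ≤
        2 * ((t - s) / s) / m := by
    intro m hm
    set y : ℕ → ℝ := fun r => s + r * ((t - s) / m) with hy
    have hmR : (0 : ℝ) < m := by exact_mod_cast hm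
    have hypos : ∀ r, 0 < y r := fun r => by positivity
    have hymono : ∀ r, y r ≤ y (r + 1) := fun r => by
      simp only [hy]; push_cast; nlinarith [div_nonneg hst' hmR.le]
    have hys : ∀ r, s ≤ y r := fun r => by
      simp only [hy]; nlinarith [mul_nonneg (Nat.cast_nonneg (α := ℝ) r) (div_nonneg hst' hmR.le)]
    have h0 : y 0 = s := by simp [hy]
    have hmm : y m = t := by simp only [hy]; field_simp; ring
    have tel : L t - L s = ∑ r ∈ Finset.range m, (L (y (r + 1)) - L (y r)) := by
      rw [Finset.sum_range_sub (fun r => L (y r)), h0, hmm]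
    have telq : q t - q s = ∑ r ∈ Finset.range m, (q (y (r + 1)) - q (y r)) := by
      rw [Finset.sum_range_sub (fun r => q (y r)), h0, hmm]
    have hlog : ∀ r, Real.log (y (r + 1)) - Real.log (y r) ≤ ((t - s) / s) / m := fun r => by
      rw [← Real.log_div (hypos _).ne' (hypos _).ne']
      refine (Real.log_le_sub_one_of_pos (div_pos (hypos _) (hypos _))).trans ?_
      have e : y (r + 1) / y r - 1 = ((t - s) / m) / y r := by
        have : y (r + 1) = y r + (t - s) / m := by simp only [hy]; push_cast; ring
        rw [this, add_div, div_self (hypos _).ne']; ring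
      rw [e, div_right_comm (t - s)]
      gcongr
      exact hys r
    have hlog0 : ∀ r, 0 ≤ Real.log (y (r + 1)) - Real.log (y r) := fun r =>
      sub_nonneg.2 (Real.log_le_log (hypos _) (hymono _))
    change |(∑ r ∈ Finset.range m, 2 * (Real.log (y (r + 1)) - Real.log (y r)) *
      ((1 + (u * y (r + 1)) ^ 2)⁻¹ - 1)) - (L s - L t)| ≤ _
    have e : (∑ r ∈ Finset.range m, 2 * (Real.log (y (r + 1)) - Real.log (y r)) *
        ((1 + (u * y (r + 1)) ^ 2)⁻¹ - 1)) - (L s - L t) =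
        ∑ r ∈ Finset.range m, ((L (y (r + 1)) - L (y r)) -
          2 * (Real.log (y (r + 1)) - Real.log (y r)) * q (y (r + 1))) := by
      rw [Finset.sum_sub_distrib, ← tel, show ∀ a b c : ℝ, a - (b - c) = (c - b) - (-a) by
        intros; ring, ← Finset.sum_neg_distrib]
      congr 1
      refine Finset.sum_congr rfl fun r _ => ?_
      simp only [hq]; ring
    rw [e]
    -- Bernoulli in both directions traps the increment of `L` between `2 * Δlog * q` at the left
    -- and at the right endpoint. Hence the error of a cell is at most `2 * Δlog` times the
    -- increment of `q`, and these increments telescope to at most `1`.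
    have term : ∀ r, (L (y (r + 1)) - L (y r)) -
        2 * (Real.log (y (r + 1)) - Real.log (y r)) * q (y (r + 1)) ≤ 0 ∧
        -(2 * (((t - s) / s) / m) * (q (y (r + 1)) - q (y r))) ≤ (L (y (r + 1)) - L (y r)) -
        2 * (Real.log (y (r + 1)) - Real.log (y r)) * q (y (r + 1)) := fun r => by
      have a1 := mul_log_le_log_one_add_sq (u := u) (hypos r) (hypos (r + 1))
      have a2 := mul_log_le_log_one_add_sq (u := u) (hypos (r + 1)) (hypos r)
      have a3 := mul_le_mul_of_nonneg_right (hlog r)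
        (sub_nonneg.2 (hqm _ _ (hypos r) (hymono r)))
      simp only [hL, hq] at a1 a2 a3 ⊢
      constructor <;> nlinarith
    rw [abs_le]
    constructor
    · calc -(2 * ((t - s) / s) / m) ≤ -(2 * (((t - s) / s) / m) * (q t - q s)) := by
            rw [neg_le_neg_iff, ← mul_div_assoc]
            have : q t - q s ≤ 1 := by linarith [hq1 t, hq0 s]
            exact mul_le_of_le_one_right (by positivity) this
        _ = ∑ r ∈ Finset.range m, -(2 * (((t - s) / s) / m) * (q (y (r + 1)) - q (y r))) := by
            rw [telq, Finset.sum_neg_distrib, Finset.mul_sum]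
        _ ≤ _ := Finset.sum_le_sum fun r _ => (term r).2
    · exact (Finset.sum_nonpos fun r _ => (term r).1).trans (by positivity)
  rw [tendsto_iff_norm_sub_tendsto_zero]
  refine squeeze_zero' (Eventually.of_forall fun m => norm_nonneg _)
    ((eventually_gt_atTop 0).mono fun m hm => ?_)
    (tendsto_const_div_atTop_nhds_zero_nat (2 * ((t - s) / s)))
  exact main m hm

end RiemannSum

/-! ### Characteristic functions of compound Poisson sums -/

section CompoundPoisson

variable {Ω : Type*} [MeasurableSpace Ω] {P : Measure Ω} {η : ℝ≥0}

lemma sum_range_sum_Ioc {M : Type*} [AddCommMonoid M] {k : ℕ → ℕ} (hk : Monotone k) (f : ℕ → M)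
    (m : ℕ) : ∑ r ∈ Finset.range m, ∑ n ∈ Finset.Ioc (k r) (k (r + 1)), f n =
      ∑ n ∈ Finset.Ioc (k 0) (k m), f n := by
  induction m with
  | zero => simp
  | succ m ih =>
    rw [Finset.sum_range_succ, ih, Finset.sum_Ioc_consecutive f (hk (Nat.zero_le m))
      (hk (Nat.le_succ m))]

/-- A product over consecutive blocks of indices, with a parameter that is constant on each block,
is a product over an initial segment. -/
lemma exists_prod_Ioc_eq_prod_range {k : ℕ → ℕ} (hk : Monotone k) (hk0 : k 0 = 0) (a₀ : ℝ)
    (a : ℕ → ℝ) (m : ℕ) : ∃ b : ℕ → ℝ, ∀ h : ℕ → ℝ → ℂ,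
      h 0 a₀ * ∏ j ∈ Finset.range m, ∏ n ∈ Finset.Ioc (k j) (k (j + 1)), h n (a j) =
        ∏ n ∈ Finset.range (k m + 1), h n (b n) := by
  induction m with
  | zero => exact ⟨fun _ => a₀, fun h => by simp [hk0]⟩
  | succ m ih =>
    obtain ⟨b, hb⟩ := ih
    refine ⟨fun n => if n ≤ k m then b n else a m, fun h => ?_⟩
    have hle : k m + 1 ≤ k (m + 1) + 1 := by have := hk m.le_succ; simp only [Nat.succ_eq_add_one] at this; omega
    rw [Finset.prod_range_succ, ← mul_assoc, hb h, ← Finset.prod_range_mul_prod_Ico _ hle]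
    congr 1
    · refine Finset.prod_congr rfl fun n hn => ?_
      dsimp only
      rw [if_pos (by have := Finset.mem_range.1 hn; omega)]
    · have hI : Finset.Ioc (k m) (k (m + 1)) = Finset.Ico (k m + 1) (k (m + 1) + 1) := by
        ext n; simp only [Finset.mem_Ioc, Finset.mem_Ico]; omega
      rw [hI]
      refine Finset.prod_congr rfl fun n hn => ?_
      dsimp only
      rw [if_neg (by have := Finset.mem_Ico.1 hn; omega)]

lemma measurable_sum_Ioc : Measurable fun q : (ℕ × ℕ) × (ℕ → ℝ) =>
    ∑ n ∈ Finset.Ioc q.1.1 q.1.2, q.2 n :=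
  measurable_from_prod_countable_right fun _ => by dsimp only; fun_prop

/-- The value at `z` of the probability generating function of a Poisson distribution. -/
lemma integral_pow_poissonMeasure (r : ℝ≥0) (z : ℂ) :
    ∫ n, z ^ n ∂(poissonMeasure r) = Complex.exp (r * (z - 1)) := by
  rw [integral_poissonMeasure]
  have h := (NormedSpace.expSeries_div_hasSum_exp ((r : ℂ) * z)).tsum_eq
  rw [← Complex.exp_eq_exp_ℂ] at h
  calc ∑' n : ℕ, (Real.exp (-r) * (r : ℝ) ^ n / n.factorial) • z ^ n
      = ∑' n : ℕ, Complex.exp (-r) * (((r : ℂ) * z) ^ n / n.factorial) := by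
        congr 1 with n
        rw [Complex.real_smul]
        push_cast
        rw [mul_pow]; ring
    _ = _ := by
        rw [tsum_mul_left, h, ← Complex.exp_add]
        congr 1; ring

lemma integral_two_div {s t : ℝ} (hs : 0 < s) (ht : 0 < t) :
    ∫ u in s..t, 2 / u = 2 * (Real.log t - Real.log s) := by
  simp_rw [div_eq_mul_inv, intervalIntegral.integral_const_mul]
  rw [integral_inv_of_pos hs ht, Real.log_div ht.ne' hs.ne']

/-- The product of characteristic functions of i.i.d. Laplace variables. -/
lemma integral_exp_sum_laplace [IsProbabilityMeasure P] {ξ : ℕ → Ω → ℝ}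
    (hξm : ∀ n, Measurable (ξ n)) (hξl : ∀ n, HasLaw (ξ n) (laplaceMeasure 1) P)
    (hξi : iIndepFun ξ P) {k : ℕ → ℕ} (hk : Monotone k) (hk0 : k 0 = 0) (a₀ : ℝ)
    (a : ℕ → ℝ) (M : ℕ) :
    ∫ ω, Complex.exp (((a₀ * ξ 0 ω + ∑ j ∈ Finset.range M,
        a j * ∑ n ∈ Finset.Ioc (k j) (k (j + 1)), ξ n ω : ℝ) : ℂ) * Complex.I) ∂P =
      ((1 + a₀ ^ 2)⁻¹ : ℝ) * ∏ j ∈ Finset.range M,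
        (((1 + a j ^ 2)⁻¹ : ℝ) : ℂ) ^ (k (j + 1) - k j) := by
  -- The same `b` serves every `h`: it regroups the exponentials before integration and the
  -- characteristic functions after it.
  obtain ⟨b, hb⟩ := exists_prod_Ioc_eq_prod_range hk hk0 a₀ a M
  have e1 : ∀ ω, Complex.exp (((a₀ * ξ 0 ω + ∑ j ∈ Finset.range M,
        a j * ∑ n ∈ Finset.Ioc (k j) (k (j + 1)), ξ n ω : ℝ) : ℂ) * Complex.I) =
      ∏ n : Finset.range (k M + 1), Complex.exp (b n * ξ n ω * Complex.I) := fun ω => by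
    rw [Finset.prod_coe_sort (Finset.range (k M + 1))
      (fun n => Complex.exp (b n * ξ n ω * Complex.I)),
      ← hb fun n c => Complex.exp (c * ξ n ω * Complex.I)]
    push_cast
    simp_rw [add_mul, Complex.exp_add, Finset.sum_mul, Complex.exp_sum, Finset.mul_sum,
      Finset.sum_mul, Complex.exp_sum]
  simp_rw [e1]
  have hi : iIndepFun (fun n : Finset.range (k M + 1) => ξ n) P :=
    hξi.precomp Subtype.val_injective
  rw [hi.integral_fun_prod_comp (f := fun (n : Finset.range (k M + 1)) (x : ℝ) => Complex.exp (b n * x * Complex.I))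
    (fun n => (hξm n).aemeasurable) (fun n => by fun_prop)]
  have e2 : ∀ (n : ℕ) (c : ℝ), ∫ ω, Complex.exp (c * ξ n ω * Complex.I) ∂P = ((1 + c ^ 2)⁻¹ : ℝ) := by
    intro n c
    have := (hξl n).integral_comp (f := fun x : ℝ => Complex.exp (c * x * Complex.I))
      (by fun_prop)
    rw [← charFun_apply_real, charFun_laplaceMeasure one_pos, mul_one] at this
    exact this
  simp_rw [e2]
  rw [Finset.prod_coe_sort (Finset.range (k M + 1)) (fun n => (((1 + b n ^ 2)⁻¹ : ℝ) : ℂ)),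
    ← hb fun n c => (((1 + c ^ 2)⁻¹ : ℝ) : ℂ)]
  simp

/-- The joint characteristic function of finitely many increments of a compound Poisson process
with Laplace jumps. -/
lemma integral_exp_sum_compound [IsProbabilityMeasure P] (hη : 0 < η) {N : Set.Ici η → Ω → ℕ}
    {ξ : ℕ → Ω → ℝ} (hN : IsPoissonProcess P η (fun u => 2 / u) N)
    (hξm : ∀ n, Measurable (ξ n)) (hξl : ∀ n, HasLaw (ξ n) (laplaceMeasure 1) P)
    (hξi : iIndepFun ξ P) (hNξ : IndepFun (fun ω t => N t ω) (fun ω n => ξ n ω) P)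
    {g : ℕ → Set.Ici η} (hg : Monotone g) (hg0 : g 0 = ⟨η, le_refl η⟩) (a₀ : ℝ)
    (a : ℕ → ℝ) (M : ℕ) :
    ∫ ω, Complex.exp (((a₀ * ξ 0 ω + ∑ j ∈ Finset.range M,
        a j * ∑ n ∈ Finset.Ioc (N (g j) ω) (N (g (j + 1)) ω), ξ n ω : ℝ) : ℂ) * Complex.I) ∂P =
      ((1 + a₀ ^ 2)⁻¹ * Real.exp (∑ j ∈ Finset.range M,
        2 * (Real.log (g (j + 1) : ℝ≥0) - Real.log (g j : ℝ≥0)) * ((1 + a j ^ 2)⁻¹ - 1)) : ℝ) := by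
  set K : Ω → ℕ → ℕ := fun ω j => N (g j) ω with hK
  set X : Ω → ℕ → ℝ := fun ω n => ξ n ω with hX
  have hKm : Measurable K := measurable_pi_lambda _ fun j => hN.measurable _
  have hXm : Measurable X := measurable_pi_lambda _ hξm
  have hi : IndepFun K X P := hNξ.comp (φ := fun p j => p (g j)) (ψ := id)
    (measurable_pi_lambda _ fun j => measurable_pi_apply _) measurable_id
  have hmono : ∀ ω, Monotone (K ω) := fun ω i j hij => hN.monotone ω (hg hij)
  -- The blocks thus begin at index `1`, which leaves `ξ 0` to the separate term with coefficient
  -- `a₀`.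
  have hK0 : ∀ ω, K ω 0 = 0 := fun ω => by simp only [hK, hg0]; exact hN.start ω
  set F : (ℕ → ℕ) × (ℕ → ℝ) → ℂ := fun q => Complex.exp (((a₀ * q.2 0 + ∑ j ∈ Finset.range M,
    a j * ∑ n ∈ Finset.Ioc (q.1 j) (q.1 (j + 1)), q.2 n : ℝ) : ℂ) * Complex.I) with hF
  have hFm : Measurable F := by
    have h1 : ∀ j, Measurable fun q : (ℕ → ℕ) × (ℕ → ℝ) =>
        ∑ n ∈ Finset.Ioc (q.1 j) (q.1 (j + 1)), q.2 n := fun j =>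
      measurable_sum_Ioc.comp (g := fun q : (ℕ × ℕ) × (ℕ → ℝ) =>
        ∑ n ∈ Finset.Ioc q.1.1 q.1.2, q.2 n)
        (f := fun q : (ℕ → ℕ) × (ℕ → ℝ) => ((q.1 j, q.1 (j + 1)), q.2)) (by fun_prop)
    fun_prop
  have hFb : ∀ q, ‖F q‖ = 1 := fun q => by simp only [hF]; exact Complex.norm_exp_ofReal_mul_I _
  have : IsProbabilityMeasure (P.map K) := Measure.isProbabilityMeasure_map hKm.aemeasurable
  have : IsProbabilityMeasure (P.map X) := Measure.isProbabilityMeasure_map hXm.aemeasurable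
  have hFi : Integrable F ((P.map K).prod (P.map X)) :=
    Integrable.of_bound hFm.aestronglyMeasurable 1 (Filter.Eventually.of_forall fun q => (hFb q).le)
  -- The counting path is frozen while the jumps are integrated out; the Poisson increments then
  -- enter as exponents.
  have inner : ∀ ω, ∫ x, F (K ω, x) ∂(P.map X) = ((1 + a₀ ^ 2)⁻¹ : ℝ) * ∏ j ∈ Finset.range M,
        (((1 + a j ^ 2)⁻¹ : ℝ) : ℂ) ^ (K ω (j + 1) - K ω j) := fun ω => by
    have hFω : Measurable fun x => F (K ω, x) := hFm.comp measurable_prodMk_left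
    rw [integral_map hXm.aemeasurable hFω.aestronglyMeasurable]
    exact integral_exp_sum_laplace hξm hξl hξi (hmono ω) (hK0 ω) a₀ a M
  calc _ = ∫ ω, F (K ω, X ω) ∂P := rfl
    _ = ∫ q, F q ∂((P.map K).prod (P.map X)) := by
        rw [← hi.map_prod_eq_prod_map_map hKm.aemeasurable hXm.aemeasurable,
          integral_map (hKm.prodMk hXm).aemeasurable hFm.aestronglyMeasurable]
    _ = ∫ ω, ∫ x, F (K ω, x) ∂(P.map X) ∂P := by
        rw [integral_prod _ hFi, integral_map hKm.aemeasurable]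
        exact hFi.integral_prod_left.aestronglyMeasurable
    _ = ((1 + a₀ ^ 2)⁻¹ : ℝ) * ∫ ω, ∏ j : Finset.range M,
        (((1 + a j ^ 2)⁻¹ : ℝ) : ℂ) ^ (N (g (j + 1)) ω - N (g j) ω) ∂P := by
        simp_rw [inner]
        rw [integral_const_mul]
        congr 2 with ω
        rw [Finset.prod_coe_sort (Finset.range M)
          (fun j => (((1 + a j ^ 2)⁻¹ : ℝ) : ℂ) ^ (N (g (j + 1)) ω - N (g j) ω))]
    _ = ((1 + a₀ ^ 2)⁻¹ : ℝ) * ∏ j : Finset.range M, Complex.exp ((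
        2 * (Real.log (g (j + 1) : ℝ≥0) - Real.log (g j : ℝ≥0)) * ((1 + a j ^ 2)⁻¹ - 1) : ℝ)) := by
        have hi' : iIndepFun (fun (j : Finset.range M) ω => N (g (j + 1)) ω - N (g j) ω) P :=
          (hN.indep_increments.nat hg).precomp (g := fun j : Finset.range M => (j : ℕ))
            Subtype.val_injective
        rw [hi'.integral_fun_prod_comp (f := fun (j : Finset.range M) (n : ℕ) => (((1 + a j ^ 2)⁻¹ : ℝ) : ℂ) ^ n)
          (fun j => ((hN.measurable _).sub (hN.measurable _)).aemeasurable)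
          (fun j => Measurable.of_discrete.aestronglyMeasurable)]
        congr 2 with j
        have hle : g j ≤ g (j + 1) := hg (Nat.le_succ _)
        have hpos : ∀ t : Set.Ici η, (0 : ℝ) < (t : ℝ≥0) := fun t => by
          exact_mod_cast hη.trans_le t.2
        have hlaw := hN.law_increments (g j) (g (j + 1)) hle
        rw [integral_two_div (hpos _) (hpos _)] at hlaw
        have := hlaw.integral_comp (f := fun n : ℕ => (((1 + a j ^ 2)⁻¹ : ℝ) : ℂ) ^ n)
          Measurable.of_discrete.aestronglyMeasurable
        refine this.trans ?_
        rw [integral_pow_poissonMeasure]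
        have hnn : 0 ≤ 2 * (Real.log (g (j + 1) : ℝ≥0) - Real.log (g j : ℝ≥0)) := by
          have := Real.log_le_log (hpos (g j)) (NNReal.coe_le_coe.2 hle)
          exact mul_nonneg zero_le_two (sub_nonneg.2 this)
        rw [show ((2 * (Real.log (g (j + 1) : ℝ≥0) - Real.log (g j : ℝ≥0))).toNNReal : ℂ) =
          ((2 * (Real.log (g (j + 1) : ℝ≥0) - Real.log (g j : ℝ≥0)) : ℝ) : ℂ) by
            rw [← Real.coe_toNNReal _ hnn]; simp]
        push_cast
        rfl
    _ = _ := by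
        rw [Finset.prod_coe_sort (Finset.range M) (fun j => Complex.exp ((
          2 * (Real.log (g (j + 1) : ℝ≥0) - Real.log (g j : ℝ≥0)) *
            ((1 + a j ^ 2)⁻¹ - 1) : ℝ))), ← Complex.exp_sum]
        push_cast
        rfl

end CompoundPoisson

/-! ### Jump times and their rounding along a single path -/

section NoisePath

open Filter Topology

variable {η : ℝ≥0}

/-- The grid point `η + j * h` of `[η, ∞)`. -/
noncomputable def gridPt (η h : ℝ≥0) (j : ℕ) : Set.Ici η := ⟨η + j * h, Set.mem_Ici.2 le_self_add⟩

lemma gridPt_mono (η h : ℝ≥0) : Monotone (gridPt η h) := fun i j hij => by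
  change η + i * h ≤ η + j * h
  gcongr

lemma gridPt_zero (η h : ℝ≥0) : gridPt η h 0 = ⟨η, le_refl η⟩ := by
  simp [gridPt]

lemma coe_gridPt (η h : ℝ≥0) (j : ℕ) : ((gridPt η h j : ℝ≥0) : ℝ) = η + j * h := by
  simp [gridPt]

lemma gridPt_div_mul (η h : ℝ≥0) (j : ℕ) {m : ℕ} (hm : 0 < m) :
    gridPt η (h / m) (j * m) = gridPt η h j := by
  have hm' : (m : ℝ≥0) ≠ 0 := by exact_mod_cast hm.ne'
  apply Subtype.ext
  simp only [gridPt]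
  push_cast
  field_simp

lemma jumpTime_zero (p : Set.Ici η → ℕ) : jumpTime p 0 = η := by
  have : {t : ℝ≥0 | ∃ h : η ≤ t, 0 ≤ p ⟨t, h⟩} = Set.Ici η := by ext; simp
  rw [jumpTime, this, csInf_Ici]

lemma jumpTime_le {p : Set.Ici η → ℕ} {n : ℕ} {t : Set.Ici η} (h : n ≤ p t) :
    jumpTime p n ≤ t :=
  csInf_le (OrderBot.bddBelow _) ⟨t.2, h⟩

/-- `ht` makes the defining set nonempty; otherwise the infimum would take the default value `0`. -/
lemma le_jumpTime {p : Set.Ici η → ℕ} (hp : Monotone p) {n : ℕ} {s t : Set.Ici η}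
    (hs : p s < n) (ht : n ≤ p t) : (s : ℝ≥0) ≤ jumpTime p n := by
  refine le_csInf ⟨t, t.2, ht⟩ ?_
  rintro r ⟨hr, hn⟩
  by_contra! hlt
  have : p ⟨r, hr⟩ ≤ p s := hp (Subtype.mk_le_mk.2 hlt.le)
  omega

lemma sum_jumpTime_sub {p : Set.Ici η → ℕ} (hp : Monotone p) (x : ℕ → ℝ) {s t : Set.Ici η}
    (hst : s ≤ t) :
    ∑ n ∈ Finset.range (p t + 1), (jumpTime p n : ℝ) * x n -
        ∑ n ∈ Finset.range (p s + 1), (jumpTime p n : ℝ) * x n =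
      ∑ n ∈ Finset.Ioc (p s) (p t), (jumpTime p n : ℝ) * x n := by
  rw [← Finset.sum_Ico_eq_sub _ (Nat.succ_le_succ (hp hst))]
  refine Finset.sum_congr ?_ fun _ _ => rfl
  ext n; simp only [Finset.mem_Ioc, Finset.mem_Ico]; omega

/-- Rounding the jump times up to the next point of a subdivision of mesh `δ`. -/
lemma abs_sum_round_sub_le {p : Set.Ici η → ℕ} (hp : Monotone p) (x : ℕ → ℝ) {k : ℕ → Set.Ici η}
    (hk : Monotone k) {δ : ℝ} (hδ : ∀ r, ((k (r + 1) : ℝ≥0) : ℝ) - (k r : ℝ≥0) ≤ δ) (m : ℕ) :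
    |∑ r ∈ Finset.range m, ((k (r + 1) : ℝ≥0) : ℝ) *
          ∑ n ∈ Finset.Ioc (p (k r)) (p (k (r + 1))), x n -
        ∑ n ∈ Finset.Ioc (p (k 0)) (p (k m)), (jumpTime p n : ℝ) * x n| ≤
      δ * ∑ n ∈ Finset.Ioc (p (k 0)) (p (k m)), |x n| := by
  have hpk : Monotone fun r => p (k r) := hp.comp hk
  rw [← sum_range_sum_Ioc hpk, ← sum_range_sum_Ioc hpk, ← Finset.sum_sub_distrib, Finset.mul_sum]
  refine (Finset.abs_sum_le_sum_abs _ _).trans (Finset.sum_le_sum fun r _ => ?_)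
  rw [Finset.mul_sum, ← Finset.sum_sub_distrib, Finset.mul_sum]
  refine (Finset.abs_sum_le_sum_abs _ _).trans (Finset.sum_le_sum fun n hn => ?_)
  obtain ⟨h1, h2⟩ := Finset.mem_Ioc.1 hn
  have h3 : ((jumpTime p n : ℝ≥0) : ℝ) ≤ (k (r + 1) : ℝ≥0) := NNReal.coe_le_coe.2 (jumpTime_le h2)
  have h4 : ((k r : ℝ≥0) : ℝ) ≤ jumpTime p n := NNReal.coe_le_coe.2 (le_jumpTime hp h1 h2)
  rw [← sub_mul, abs_mul]
  gcongr
  rw [abs_of_nonneg (by linarith)]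
  linarith [hδ r]

/-- Finitely many jumps fall in the cell, and each is displaced by at most the mesh `h / m`. The
rounded sums see the counting path only at grid points, so they are measurable and their laws can be
computed. -/
lemma tendsto_sum_round {p : Set.Ici η → ℕ} (hp : Monotone p) (x : ℕ → ℝ) (h : ℝ≥0) (j : ℕ) :
    Tendsto (fun m : ℕ => ∑ r ∈ Finset.range m,
        ((gridPt η (h / m) (j * m + r + 1) : ℝ≥0) : ℝ) *
          ∑ n ∈ Finset.Ioc (p (gridPt η (h / m) (j * m + r)))
            (p (gridPt η (h / m) (j * m + r + 1))), x n) atTop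
      (𝓝 (∑ n ∈ Finset.range (p (gridPt η h (j + 1)) + 1), (jumpTime p n : ℝ) * x n -
        ∑ n ∈ Finset.range (p (gridPt η h j) + 1), (jumpTime p n : ℝ) * x n)) := by
  rw [sum_jumpTime_sub hp x (gridPt_mono η h (Nat.le_succ j)), tendsto_iff_norm_sub_tendsto_zero]
  set C := ∑ n ∈ Finset.Ioc (p (gridPt η h j)) (p (gridPt η h (j + 1))), |x n| with hC
  have hlim : Tendsto (fun m : ℕ => (h : ℝ) / m * C) atTop (𝓝 0) := by
    simpa using (tendsto_const_div_atTop_nhds_zero_nat (h : ℝ)).mul_const C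
  refine squeeze_zero' (Eventually.of_forall fun m => norm_nonneg _)
    ((eventually_gt_atTop 0).mono fun m hm => ?_) hlim
  have key := abs_sum_round_sub_le hp x (k := fun r => gridPt η (h / m) (j * m + r))
    (fun a b hab => gridPt_mono η _ (by omega)) (δ := (h : ℝ) / m) (fun r => by
      simp only [coe_gridPt]; push_cast; apply le_of_eq; ring) m
  simp only [add_zero, gridPt_div_mul η h j hm] at key
  rw [show j * m + m = (j + 1) * m by ring, gridPt_div_mul η h _ hm] at key
  exact key

end NoisePath

/-! ### Joint characteristic function of the noise increments -/

section NoiseLaw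

open Filter Topology

variable {Ω : Type*} [MeasurableSpace Ω] {P : Measure Ω} {η : ℝ≥0}

lemma sum_range_mul_div {M m : ℕ} (hm : 0 < m) (f : ℕ → ℕ → ℝ) :
    ∑ i ∈ Finset.range (M * m), f (i / m) i =
      ∑ j ∈ Finset.range M, ∑ r ∈ Finset.range m, f j (j * m + r) := by
  induction M with
  | zero => simp
  | succ M ih =>
    rw [Nat.succ_mul, Finset.sum_range_add, ih, Finset.sum_range_succ]
    congr 1
    refine Finset.sum_congr rfl fun r hr => ?_
    rw [mul_comm, Nat.mul_add_div hm, Nat.div_eq_of_lt (Finset.mem_range.1 hr), add_zero]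

/-- The increments of a process along a sequence of times, starting with its first value. -/
def pathIncr (g : ℕ → Set.Ici η) (z : Set.Ici η → ℝ) : ℕ → ℝ
  | 0 => z (g 0)
  | j + 1 => z (g (j + 1)) - z (g j)

lemma sum_pathIncr (g : ℕ → Set.Ici η) (z : Set.Ici η → ℝ) (k : ℕ) :
    ∑ j ∈ Finset.range (k + 1), pathIncr g z j = z (g k) := by
  induction k with
  | zero => simp [pathIncr]
  | succ k ih => rw [Finset.sum_range_succ, ih]; simp [pathIncr]

/-- The characteristic functions of the increments of a Laplace noise process along a grid. -/
noncomputable def incrCharFun (η h : ℝ≥0) : ℕ → ℝ → ℝ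
  | 0, u => (1 + (u * η) ^ 2)⁻¹
  | j + 1, u => (1 + (u * (gridPt η h j : ℝ≥0)) ^ 2) / (1 + (u * (gridPt η h (j + 1) : ℝ≥0)) ^ 2)

/-- The quotients telescope, and what remains is the characteristic function of a Laplace law. -/
lemma prod_incrCharFun (η h : ℝ≥0) (k : ℕ) (u : ℝ) :
    ∏ j ∈ Finset.range (k + 1), incrCharFun η h j u = (1 + (u * (gridPt η h k : ℝ≥0)) ^ 2)⁻¹ := by
  induction k with
  | zero => simp [incrCharFun, gridPt_zero]
  | succ k ih =>
    rw [Finset.prod_range_succ, ih, incrCharFun]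
    have : 1 + (u * (gridPt η h k : ℝ≥0)) ^ 2 ≠ 0 := by positivity
    field_simp

lemma incrCharFun_zero (η h : ℝ≥0) (j : ℕ) : incrCharFun η h j 0 = 1 := by
  cases j <;> simp [incrCharFun]

variable {Z : Set.Ici η → Ω → ℝ}

/-- A jump time is an infimum over uncountably many times, so `Z t` is written instead as a
pointwise limit of sums with rounded jump times, `t` being the first point of the grid of mesh `t -
η`. -/
lemma IsLaplaceNoise.measurable (hZ : IsLaplaceNoise P η Z) (t : Set.Ici η) : Measurable (Z t) := by
  obtain ⟨N, ξ, hN, hξm, -, -, -, hZ⟩ := hZ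
  obtain ⟨h, ht⟩ : ∃ h : ℝ≥0, t = gridPt η h 1 := by
    refine ⟨t - η, Subtype.ext ?_⟩
    simp only [gridPt, Nat.cast_one, one_mul]
    exact (add_tsub_cancel_of_le (Set.mem_Ici.1 t.2)).symm
  have hlim : ∀ ω, _ := fun ω => tendsto_sum_round (hN.monotone ω) (fun n => ξ n ω) h 0
  have hdiff : Measurable fun ω => Z t ω - η * ξ 0 ω := by
    refine measurable_of_tendsto_metrizable (fun m => ?_) (tendsto_pi_nhds.2 fun ω => ?_)
      (f := fun m ω => ∑ r ∈ Finset.range m, ((gridPt η (h / m) (0 * m + r + 1) : ℝ≥0) : ℝ) *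
          ∑ n ∈ Finset.Ioc (N (gridPt η (h / m) (0 * m + r)) ω)
            (N (gridPt η (h / m) (0 * m + r + 1)) ω), ξ n ω)
    · refine Finset.measurable_fun_sum _ fun r _ => Measurable.const_mul ?_ _
      exact measurable_sum_Ioc.comp (g := fun q : (ℕ × ℕ) × (ℕ → ℝ) =>
        ∑ n ∈ Finset.Ioc q.1.1 q.1.2, q.2 n)
        (((hN.measurable _).prodMk (hN.measurable _)).prodMk (measurable_pi_lambda _ hξm))
    · have := hlim ω
      rw [gridPt_zero] at this
      simp only [hN.start, zero_add, Finset.sum_range_one, jumpTime_zero] at this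
      rw [ht, hZ]
      exact this
  have hsum := hdiff.add ((hξm 0).const_mul (η : ℝ))
  simpa only [Pi.add_def, sub_add_cancel] using hsum

/-- The joint characteristic function of the increments of a Laplace noise process along a grid. -/
lemma IsLaplaceNoise.integral_exp_sum_pathIncr [IsProbabilityMeasure P] (hη : 0 < η)
    (hZ : IsLaplaceNoise P η Z) (h : ℝ≥0) (M : ℕ) (v : ℕ → ℝ) :
    ∫ ω, Complex.exp (((∑ j ∈ Finset.range (M + 1),
        v j * pathIncr (gridPt η h) (fun t => Z t ω) j : ℝ) : ℂ) * Complex.I) ∂P =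
      (∏ j ∈ Finset.range (M + 1), incrCharFun η h j (v j) : ℝ) := by
  have hZm := hZ.measurable
  obtain ⟨N, ξ, hN, hξm, hξl, hξi, hNξ, hZ⟩ := hZ
  -- Fine cell `i` lies in coarse cell `i / m`, whose increment has index `i / m + 1` because index
  -- `0` is the initial value.
  set a : ℕ → ℕ → ℝ := fun m i => v (i / m + 1) * (gridPt η (h / m) (i + 1) : ℝ≥0) with ha
  set S : ℕ → Ω → ℝ := fun m ω => v 0 * η * ξ 0 ω + ∑ i ∈ Finset.range (M * m),
    a m i * ∑ n ∈ Finset.Ioc (N (gridPt η (h / m) i) ω) (N (gridPt η (h / m) (i + 1)) ω), ξ n ω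
    with hS
  have hSm : ∀ m, Measurable (S m) := fun m => by
    refine ((hξm 0).const_mul _).add (Finset.measurable_fun_sum _ fun r _ => Measurable.const_mul ?_ _)
    exact measurable_sum_Ioc.comp (g := fun q : (ℕ × ℕ) × (ℕ → ℝ) =>
      ∑ n ∈ Finset.Ioc q.1.1 q.1.2, q.2 n)
      (((hN.measurable _).prodMk (hN.measurable _)).prodMk (measurable_pi_lambda _ hξm))
  have hSlim : ∀ ω, Tendsto (fun m => S m ω) atTop (𝓝 (∑ j ∈ Finset.range (M + 1),
      v j * pathIncr (gridPt η h) (fun t => Z t ω) j)) := fun ω => by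
    have h0 : v 0 * pathIncr (gridPt η h) (fun t => Z t ω) 0 = v 0 * η * ξ 0 ω := by
      simp [pathIncr, gridPt_zero, hZ, hN.start, jumpTime_zero, mul_assoc]
    rw [Finset.sum_range_succ', h0, add_comm]
    refine Tendsto.add tendsto_const_nhds (?_)
    have hsum := tendsto_finsetSum (Finset.range M) fun j _ =>
      (tendsto_sum_round (hN.monotone ω) (fun n => ξ n ω) h j).const_mul (v (j + 1))
    simp_rw [← hZ] at hsum
    refine hsum.congr' ?_
    filter_upwards [eventually_gt_atTop 0] with m hm
    rw [sum_range_mul_div hm fun j i => v (j + 1) * (gridPt η (h / m) (i + 1) : ℝ≥0) *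
        ∑ n ∈ Finset.Ioc (N (gridPt η (h / m) i) ω) (N (gridPt η (h / m) (i + 1)) ω), ξ n ω]
    simp_rw [Finset.mul_sum, mul_assoc]
  have hL : Tendsto (fun m => ∫ ω, Complex.exp ((S m ω : ℂ) * Complex.I) ∂P) atTop
      (𝓝 (∫ ω, Complex.exp (((∑ j ∈ Finset.range (M + 1),
        v j * pathIncr (gridPt η h) (fun t => Z t ω) j : ℝ) : ℂ) * Complex.I) ∂P)) := by
    refine tendsto_integral_of_dominated_convergence (fun _ => 1) (fun m => ?_) (integrable_const _)
      (fun m => Eventually.of_forall fun ω => (Complex.norm_exp_ofReal_mul_I _).le)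
      (Eventually.of_forall fun ω => ?_)
    · have := hSm m
      exact Measurable.aestronglyMeasurable (by fun_prop)
    · exact ((Complex.continuous_exp.comp
        (Complex.continuous_ofReal.mul continuous_const)).tendsto _).comp (hSlim ω)
  refine tendsto_nhds_unique hL ?_
  simp_rw [hS, integral_exp_sum_compound hη hN hξm hξl hξi hNξ (gridPt_mono η _) (gridPt_zero η _)]
  refine (Complex.continuous_ofReal.tendsto _).comp ?_
  rw [Finset.prod_range_succ', mul_comm _ (incrCharFun η h 0 (v 0))]
  refine Tendsto.mul (tendsto_const_nhds.congr fun _ => by simp [incrCharFun]) ?_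
  have hlog : ∏ j ∈ Finset.range M, incrCharFun η h (j + 1) (v (j + 1)) =
      Real.exp (∑ j ∈ Finset.range M, (Real.log (1 + (v (j + 1) * (gridPt η h j : ℝ≥0)) ^ 2) -
        Real.log (1 + (v (j + 1) * (gridPt η h (j + 1) : ℝ≥0)) ^ 2))) := by
    rw [Real.exp_sum]
    refine Finset.prod_congr rfl fun j _ => ?_
    rw [← Real.log_div (by positivity) (by positivity), Real.exp_log (by positivity), incrCharFun]
  rw [hlog]
  refine (Real.continuous_exp.tendsto _).comp ?_
  refine (tendsto_finsetSum _ fun j _ => tendsto_sum_log_mul (s := (gridPt η h j : ℝ≥0))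
    (t := (gridPt η h (j + 1) : ℝ≥0)) (NNReal.coe_pos.2 (hη.trans_le (gridPt η h j).2))
    (NNReal.coe_le_coe.2 (gridPt_mono η h (Nat.le_succ j))) (v (j + 1))).congr' ?_
  filter_upwards [eventually_gt_atTop 0] with m hm
  have hmR : (m : ℝ) ≠ 0 := by exact_mod_cast hm.ne'
  rw [sum_range_mul_div hm fun j i => 2 * (Real.log (gridPt η (h / m) (i + 1) : ℝ≥0) -
    Real.log (gridPt η (h / m) i : ℝ≥0)) *
    ((1 + (v (j + 1) * (gridPt η (h / m) (i + 1) : ℝ≥0)) ^ 2)⁻¹ - 1)]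
  refine Finset.sum_congr rfl fun j _ => Finset.sum_congr rfl fun r _ => ?_
  have e : ∀ i : ℕ, ((gridPt η h j : ℝ≥0) : ℝ) + i *
      ((((gridPt η h (j + 1) : ℝ≥0) : ℝ) - (gridPt η h j : ℝ≥0)) / m) =
      (gridPt η (h / m) (j * m + i) : ℝ≥0) := fun i => by
    simp only [coe_gridPt]; push_cast; field_simp; ring
  rw [e, e, add_assoc]

end NoiseLaw

/-! ### Independent increments and translates of the noise -/

section GridLaw

variable {Ω : Type*} [MeasurableSpace Ω] {P : Measure Ω} {η : ℝ≥0} {Z : Set.Ici η → Ω → ℝ}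

lemma IsLaplaceNoise.measurable_pathIncr (hZ : IsLaplaceNoise P η Z) (g : ℕ → Set.Ici η) (j : ℕ) :
    Measurable fun ω => pathIncr g (fun t => Z t ω) j := by
  cases j with
  | zero => exact hZ.measurable _
  | succ j => exact (hZ.measurable _).sub (hZ.measurable _)

lemma IsLaplaceNoise.charFun_pathIncr [IsProbabilityMeasure P] (hη : 0 < η)
    (hZ : IsLaplaceNoise P η Z) (h : ℝ≥0) (j : ℕ) (u : ℝ) :
    charFun (P.map fun ω => pathIncr (gridPt η h) (fun t => Z t ω) j) u =
      (incrCharFun η h j u : ℝ) := by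
  have key := hZ.integral_exp_sum_pathIncr hη h j (Pi.single j u)
  have hs : ∀ i ∈ Finset.range (j + 1), i ≠ j → incrCharFun η h i ((Pi.single j u : ℕ → ℝ) i) = 1 :=
    fun i _ hi => by rw [Pi.single_eq_of_ne hi, incrCharFun_zero]
  rw [Finset.prod_eq_single j hs (by simp), Pi.single_eq_same] at key
  rw [← key, charFun_apply_real,
    integral_map (hZ.measurable_pathIncr _ j).aemeasurable (by fun_prop)]
  congr 1 with ω
  rw [Finset.sum_eq_single j (fun i _ hi => by rw [Pi.single_eq_of_ne hi, zero_mul]) (by simp),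
    Pi.single_eq_same]
  push_cast
  rfl

/-- The joint characteristic function is the product of the marginal ones; every finite index set
sits inside an initial segment. -/
lemma IsLaplaceNoise.iIndepFun_pathIncr [IsProbabilityMeasure P] (hη : 0 < η)
    (hZ : IsLaplaceNoise P η Z) (h : ℝ≥0) :
    iIndepFun (fun j ω => pathIncr (gridPt η h) (fun t => Z t ω) j) P := by
  have hfin : ∀ M : ℕ, iIndepFun (fun (j : Fin (M + 1)) ω =>
      pathIncr (gridPt η h) (fun t => Z t ω) j) P := by
    intro M
    rw [iIndepFun_iff_charFun_pi fun j : Fin (M + 1) =>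
      (hZ.measurable_pathIncr (gridPt η h) j).aemeasurable]
    intro t
    set v : ℕ → ℝ := fun j => if hj : j < M + 1 then t ⟨j, hj⟩ else 0 with hv
    have hvt : ∀ j : Fin (M + 1), v j = t j := fun j => dif_pos j.2
    have hm : Measurable fun ω => WithLp.toLp 2 fun j : Fin (M + 1) =>
        pathIncr (gridPt η h) (fun t => Z t ω) j :=
      (PiLp.continuous_toLp 2 _).measurable.comp
        (measurable_pi_lambda _ fun j => hZ.measurable_pathIncr _ j)
    rw [charFun_apply, integral_map hm.aemeasurable (by fun_prop)]
    simp_rw [hZ.charFun_pathIncr hη h, ← hvt]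
    have key := hZ.integral_exp_sum_pathIncr hη h M v
    rw [← Fin.prod_univ_eq_prod_range (fun j => incrCharFun η h j (v j))] at key
    push_cast at key
    rw [← key]
    congr 1 with ω
    congr 2
    rw [PiLp.inner_apply, ← Fin.sum_univ_eq_sum_range
      (fun j => (v j : ℂ) * (pathIncr (gridPt η h) (fun t => Z t ω) j : ℂ))]
    push_cast
    refine Finset.sum_congr rfl fun j _ => ?_
    rw [hvt]
    simp
  refine iIndepFun_iff_finset.2 fun s => ?_
  obtain ⟨M, hM⟩ := s.exists_nat_subset_range
  exact (hfin M).precomp (g := fun i : s => ⟨i, (Finset.mem_range.1 (hM i.2)).trans M.lt_succ_self⟩)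
    fun i j hij => Subtype.ext (by simpa using hij)

/-- The marginal law of a Laplace noise process at time `t` is the Laplace distribution of
scale `t`. -/
lemma IsLaplaceNoise.map_gridPt [IsProbabilityMeasure P] (hη : 0 < η) (hZ : IsLaplaceNoise P η Z)
    (h : ℝ≥0) (k : ℕ) : P.map (Z (gridPt η h k)) = laplaceMeasure (gridPt η h k : ℝ≥0) := by
  have hpos : (0 : ℝ) < (gridPt η h k : ℝ≥0) := NNReal.coe_pos.2 (hη.trans_le (gridPt η h k).2)
  have : Fact ((0 : ℝ) < (gridPt η h k : ℝ≥0)) := ⟨hpos⟩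
  have := Measure.isProbabilityMeasure_map (μ := P) (hZ.measurable (gridPt η h k)).aemeasurable
  refine Measure.ext_of_charFun (funext fun u => ?_)
  rw [charFun_laplaceMeasure hpos, ← prod_incrCharFun,
    ← hZ.integral_exp_sum_pathIncr hη h k fun _ => u, charFun_apply_real,
    integral_map (hZ.measurable _).aemeasurable (by fun_prop)]
  congr 1 with ω
  rw [← Finset.mul_sum, sum_pathIncr]
  push_cast
  rfl

lemma sum_Ioc_pathIncr (g : ℕ → Set.Ici η) (z : Set.Ici η → ℝ) {k j : ℕ} (hkj : k ≤ j) :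
    ∑ i ∈ Finset.Ioc k j, pathIncr g z i = z (g j) - z (g k) := by
  rw [← sum_pathIncr g z j, ← sum_pathIncr g z k, ← Finset.sum_Ico_eq_sub _ (Nat.succ_le_succ hkj)]
  refine Finset.sum_congr ?_ fun _ _ => rfl
  ext n; simp only [Finset.mem_Ioc, Finset.mem_Ico]; omega

/-- Given its later increments, a Laplace noise process at time `t` still has the Laplace
distribution of scale `t`, so that the laws of two translates of the process after time `t` have a
bounded ratio. -/
lemma IsLaplaceNoise.map_const_add_le [IsProbabilityMeasure P] (hη : 0 < η)
    (hZ : IsLaplaceNoise P η Z) (h : ℝ≥0) (k M : ℕ) (c c' : ℝ) :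
    P.map (fun ω (j : Fin (M + 1)) => c + Z (gridPt η h (max j k)) ω) ≤
      ENNReal.ofReal (Real.exp (|c - c'| / (gridPt η h k : ℝ≥0))) •
        P.map (fun ω (j : Fin (M + 1)) => c' + Z (gridPt η h (max j k)) ω) := by
  have hpos : (0 : ℝ) < (gridPt η h k : ℝ≥0) := NNReal.coe_pos.2 (hη.trans_le (gridPt η h k).2)
  have : Fact ((0 : ℝ) < (gridPt η h k : ℝ≥0)) := ⟨hpos⟩
  set Y : ℕ → Ω → ℝ := fun j ω => pathIncr (gridPt η h) (fun t => Z t ω) j with hY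
  have hYm : ∀ j, Measurable (Y j) := hZ.measurable_pathIncr _
  set W : Ω → Finset.Ioc k M → ℝ := fun ω i => Y i ω with hW
  have hWm : Measurable W := measurable_pi_lambda _ fun i => hYm i
  -- The value at index `k` is the sum of the increments of index at most `k`, while `W` holds those
  -- of larger index.
  have hind : IndepFun (Z (gridPt η h k)) W P := by
    have h1 := (hZ.iIndepFun_pathIncr hη h).indepFun_finset (Finset.range (k + 1))
      (Finset.Ioc k M) (by
        rw [Finset.disjoint_left]; intro a ha hb
        have := Finset.mem_range.1 ha; have := Finset.mem_Ioc.1 hb; omega) hYm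
    have h2 := h1.comp (φ := fun w : Finset.range (k + 1) → ℝ => ∑ i, w i) (ψ := id)
      (by fun_prop) measurable_id
    refine h2.congr (Filter.Eventually.of_forall fun ω => ?_) Filter.EventuallyEq.rfl
    simp only [Function.comp_apply]
    rw [Finset.sum_coe_sort (Finset.range (k + 1))
      (fun i => pathIncr (gridPt η h) (fun t => Z t ω) i), sum_pathIncr]
  -- Rebuilds the path, frozen before index `k`, from its value at `k` and its later increments. The
  -- shift `c` enters only through the first argument.
  set Ψ : ℝ × (Finset.Ioc k M → ℝ) → Fin (M + 1) → ℝ :=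
    fun q j => q.1 + ∑ i : Finset.Ioc k M, if (i : ℕ) ≤ max (j : ℕ) k then q.2 i else 0 with hΨ
  have hΨm : Measurable Ψ := by
    refine measurable_pi_lambda _ fun j => measurable_fst.add ?_
    refine Finset.measurable_fun_sum _ fun i _ => ?_
    split_ifs <;> fun_prop
  have hrep : ∀ c, P.map (fun ω (j : Fin (M + 1)) => c + Z (gridPt η h (max j k)) ω) =
      (((laplaceMeasure (gridPt η h k : ℝ≥0)).map (c + ·)).prod (P.map W)).map Ψ := by
    intro c
    have hindc : IndepFun (fun ω => c + Z (gridPt η h k) ω) W P :=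
      hind.comp (φ := (c + ·)) (ψ := id) (measurable_const_add c) measurable_id
    have hZc : Measurable fun ω => c + Z (gridPt η h k) ω := (hZ.measurable _).const_add c
    rw [← hZ.map_gridPt hη, Measure.map_map (measurable_const_add c) (hZ.measurable _),
      show (fun x => c + x) ∘ Z (gridPt η h k) = fun ω => c + Z (gridPt η h k) ω from rfl,
      ← hindc.map_prod_eq_prod_map_map hZc.aemeasurable hWm.aemeasurable,
      Measure.map_map hΨm (hZc.prodMk hWm)]
    congr 1
    ext ω j
    simp only [hΨ, hW, Function.comp_apply]
    rw [Finset.sum_coe_sort (Finset.Ioc k M) (fun i => if i ≤ max (j : ℕ) k then Y i ω else 0),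
      ← Finset.sum_filter]
    have hf : (Finset.Ioc k M).filter (fun i => i ≤ max (j : ℕ) k) =
        Finset.Ioc k (max (j : ℕ) k) := by
      ext i
      have := j.2
      simp only [Finset.mem_filter, Finset.mem_Ioc]
      omega
    rw [hf, sum_Ioc_pathIncr _ _ (le_max_right _ _)]
    ring
  have := Measure.isProbabilityMeasure_map (μ := P) hWm.aemeasurable
  rw [hrep, hrep, ← Measure.map_smul, ← Measure.prod_smul_left]
  exact Measure.map_mono (Measure.prod_mono (map_const_add_laplaceMeasure_le hpos c c') le_rfl) hΨm

/-- The product outer measure is the largest one bounded on boxes by the product of the factors, so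
boxes are enough once the constant is moved to the left. -/
lemma pi_le_smul_pi {ι : Type*} [Fintype ι] {α : ι → Type*} [∀ i, MeasurableSpace (α i)]
    {μ ν : ∀ i, Measure (α i)} [∀ i, SigmaFinite (μ i)] [∀ i, SigmaFinite (ν i)] {C : ι → ℝ≥0∞}
    (hC0 : ∀ i, C i ≠ 0) (hC : ∀ i, C i ≠ ∞) (hle : ∀ i, μ i ≤ C i • ν i) :
    Measure.pi μ ≤ (∏ i, C i) • Measure.pi ν := by
  have hprod0 : ∏ i, C i ≠ 0 := Finset.prod_ne_zero_iff.2 fun i _ => hC0 i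
  have hprod : ∏ i, C i ≠ ∞ := ENNReal.prod_ne_top fun i _ => hC i
  have key : ((∏ i, C i)⁻¹ • Measure.pi μ).toOuterMeasure ≤
      OuterMeasure.pi fun i => (ν i).toOuterMeasure := by
    rw [OuterMeasure.le_pi]
    intro s _
    change (∏ i, C i)⁻¹ * Measure.pi μ (Set.univ.pi s) ≤ ∏ i, ν i (s i)
    rw [Measure.pi_pi, ← ENNReal.div_eq_inv_mul]
    refine ENNReal.div_le_of_le_mul' ?_
    rw [← Finset.prod_mul_distrib]
    exact Finset.prod_le_prod' fun i _ => by simpa using hle i (s i)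
  refine Measure.le_iff.2 fun s hs => ?_
  have h1 : (∏ i, C i)⁻¹ * Measure.pi μ s ≤ Measure.pi ν s := by
    conv_rhs => rw [Measure.pi, toMeasure_apply _ _ hs]
    exact key s
  rwa [Measure.smul_apply, smul_eq_mul, ← ENNReal.inv_mul_le_iff hprod0 hprod]

lemma IsLaplaceNoiseProcess.measurable {d : ℕ} {Z : Set.Ici η → Ω → Fin d → ℝ}
    (hZ : IsLaplaceNoiseProcess P η Z) (t : Set.Ici η) : Measurable (Z t) :=
  measurable_pi_lambda _ fun i => (hZ.1 i).measurable t

/-- Coordinates are independent, so the one-dimensional constants multiply and the exponents add up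
to the `ℓ¹` distance. -/
lemma IsLaplaceNoiseProcess.map_const_add_le [IsProbabilityMeasure P] (hη : 0 < η) {d : ℕ}
    {Z : Set.Ici η → Ω → Fin d → ℝ} (hZ : IsLaplaceNoiseProcess P η Z) (h : ℝ≥0) (k M : ℕ)
    (c c' : Fin d → ℝ) :
    P.map (fun ω (j : Fin (M + 1)) => c + Z (gridPt η h (max j k)) ω) ≤
      ENNReal.ofReal (Real.exp ((∑ i, |c i - c' i|) / (gridPt η h k : ℝ≥0))) •
        P.map (fun ω (j : Fin (M + 1)) => c' + Z (gridPt η h (max j k)) ω) := by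
  have hm : ∀ (c : Fin d → ℝ) (i : Fin d), Measurable fun ω (j : Fin (M + 1)) =>
      c i + Z (gridPt η h (max j k)) ω i := fun c i =>
    measurable_pi_lambda _ fun j => ((hZ.1 i).measurable _).const_add _
  have hswap : Measurable fun (w : Fin d → Fin (M + 1) → ℝ) (j : Fin (M + 1)) (i : Fin d) =>
      w i j := by fun_prop
  have hrep : ∀ c : Fin d → ℝ,
      P.map (fun ω (j : Fin (M + 1)) => c + Z (gridPt η h (max j k)) ω) =
        (Measure.pi fun i => P.map fun ω (j : Fin (M + 1)) =>
          c i + Z (gridPt η h (max j k)) ω i).map fun w j i => w i j := by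
    intro c
    have hind : iIndepFun (fun (i : Fin d) ω (j : Fin (M + 1)) =>
        c i + Z (gridPt η h (max j k)) ω i) P :=
      hZ.2.comp (fun i z (j : Fin (M + 1)) => c i + z (gridPt η h (max j k))) fun i => by fun_prop
    rw [← (iIndepFun_iff_map_fun_eq_pi_map fun i => (hm c i).aemeasurable).1 hind,
      Measure.map_map hswap (measurable_pi_lambda _ (hm c))]
    rfl
  have := fun (c : Fin d → ℝ) (i : Fin d) =>
    Measure.isProbabilityMeasure_map (μ := P) (hm c i).aemeasurable
  rw [hrep, hrep, ← Measure.map_smul]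
  refine Measure.map_mono ((pi_le_smul_pi (fun i => ?_) (fun i => ENNReal.ofReal_ne_top)
    fun i => (hZ.1 i).map_const_add_le hη h k M (c i) (c' i)).trans (le_of_eq ?_)) hswap
  · simpa using Real.exp_pos _
  · rw [← ENNReal.ofReal_prod_of_nonneg fun i _ => (Real.exp_pos _).le, ← Real.exp_sum,
      Finset.sum_div]

end GridLaw

/-! ### Dependence of the iterates on the noise path -/

section Path

variable {d : ℕ} {η : ℝ≥0} {T : (n : ℕ) → (Fin n → Fin d → ℝ) → Set.Ici η}

/-- The time of the iterate with index `n` along a noise path. -/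
def lnrTime (T : (n : ℕ) → (Fin n → Fin d → ℝ) → Set.Ici η) (c : Fin d → ℝ)
    (z : Set.Ici η → Fin d → ℝ) (n : ℕ) : Set.Ici η :=
  T n fun j => lnrPath T c z j

lemma lnrPath_eq (T : (n : ℕ) → (Fin n → Fin d → ℝ) → Set.Ici η) (c : Fin d → ℝ)
    (z : Set.Ici η → Fin d → ℝ) (n : ℕ) : lnrPath T c z n = c + z (lnrTime T c z n) := by
  rw [lnrPath, lnrTime]

lemma lnrTime_antitone (hT : IsTimeFunctions T) (c : Fin d → ℝ) (z : Set.Ici η → Fin d → ℝ) :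
    Antitone (lnrTime T c z) :=
  antitone_nat_of_succ_le fun n => hT.antitone n fun j => lnrPath T c z j

/-- The input matters only through the shifted path `c + z`, whose law is the object to compare. -/
lemma lnrPath_eq_zero_add (T : (n : ℕ) → (Fin n → Fin d → ℝ) → Set.Ici η) (c : Fin d → ℝ)
    (z : Set.Ici η → Fin d → ℝ) (n : ℕ) :
    lnrPath T c z n = lnrPath T 0 (fun t => c + z t) n := by
  induction n using Nat.strong_induction_on with
  | _ n ih =>
    rw [lnrPath_eq, lnrPath_eq, lnrTime, lnrTime, zero_add]
    simp_rw [fun j : Fin n => ih j j.2]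

/-- The first iterates only depend on the noise path after the current time. -/
lemma lnrPath_congr (hT : IsTimeFunctions T) (c : Fin d → ℝ) {z z' : Set.Ici η → Fin d → ℝ}
    {n : ℕ} (hz : ∀ i β, lnrTime T c z n ≤ T i β → z (T i β) = z' (T i β)) {i : ℕ} (hi : i ≤ n) :
    lnrPath T c z i = lnrPath T c z' i := by
  induction i using Nat.strong_induction_on with
  | _ i ih =>
    have ht : lnrTime T c z i = lnrTime T c z' i := by
      rw [lnrTime, lnrTime]
      simp_rw [fun j : Fin i => ih j j.2 (j.2.le.trans hi)]
    rw [lnrPath_eq, lnrPath_eq, ← ht, lnrTime, hz _ _ (lnrTime_antitone hT c z hi)]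

lemma lnrTime_congr (hT : IsTimeFunctions T) (c : Fin d → ℝ) {z z' : Set.Ici η → Fin d → ℝ}
    {n : ℕ} (hz : ∀ i β, lnrTime T c z n ≤ T i β → z (T i β) = z' (T i β)) :
    lnrTime T c z n = lnrTime T c z' n := by
  rw [lnrTime, lnrTime]
  simp_rw [fun j : Fin n => lnrPath_congr hT c hz j.2.le]

end Path

/-! ### Rounding the time functions to finite grids -/

section Rounding

open Filter Topology

variable {η : ℝ≥0}

/-- The index of the first of the grid points `η + j * h`, `j ≤ M`, that is at least `t`, or `M` if
there is none. -/
noncomputable def gridIdx (η h : ℝ≥0) (M : ℕ) (t : Set.Ici η) : Fin (M + 1) :=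
  ⟨min ⌈((t : ℝ≥0) - η) / h⌉₊ M, Nat.lt_succ_of_le (min_le_right _ _)⟩

/-- Rounding a time up to a finite grid. -/
noncomputable def roundUp (η h : ℝ≥0) (M : ℕ) (t : Set.Ici η) : Set.Ici η :=
  gridPt η h (gridIdx η h M t)

lemma gridIdx_mono (η h : ℝ≥0) (M : ℕ) : Monotone (gridIdx η h M) := fun s t hst => by
  refine Fin.mk_le_mk.2 (min_le_min_right _ (Nat.ceil_mono ?_))
  have : (s : ℝ≥0) ≤ t := hst
  gcongr

lemma roundUp_mono (η h : ℝ≥0) (M : ℕ) : Monotone (roundUp η h M) :=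
  fun _ _ hst => gridPt_mono η h (gridIdx_mono η h M hst)

lemma measurable_gridIdx (η h : ℝ≥0) (M : ℕ) : Measurable (gridIdx η h M) :=
  (gridIdx_mono η h M).measurable

lemma measurable_roundUp (η h : ℝ≥0) (M : ℕ) : Measurable (roundUp η h M) :=
  (Measurable.of_discrete (f := fun j : Fin (M + 1) => gridPt η h j)).comp
    (measurable_gridIdx η h M)

lemma gridIdx_gridPt {h : ℝ≥0} (hh : 0 < h) {M : ℕ} (j : Fin (M + 1)) :
    gridIdx η h M (gridPt η h j) = j := by
  ext
  simp only [gridIdx, gridPt, add_tsub_cancel_left]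
  rw [mul_div_cancel_right₀ _ hh.ne', Nat.ceil_natCast, min_eq_left (Nat.lt_succ_iff.1 j.2)]

lemma gridPt_le_gridPt {h : ℝ≥0} (hh : 0 < h) {i j : ℕ} :
    gridPt η h i ≤ gridPt η h j ↔ i ≤ j := by
  refine ⟨fun hij => ?_, fun hij => gridPt_mono η h hij⟩
  have : η + i * h ≤ η + j * h := hij
  have := le_of_mul_le_mul_right (le_of_add_le_add_left this) hh
  exact_mod_cast this

/-- With mesh `1 / (k + 1)` and `(k + 1) ^ 2` cells the grid ends at `η + k + 1`, so it eventually
passes `t` and rounding overshoots by at most the mesh. Convergence from the right is essential,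
since paths are locally constant only on that side. -/
lemma tendsto_roundUp (t : Set.Ici η) :
    Tendsto (fun k : ℕ => roundUp η (1 / (k + 1 : ℕ)) ((k + 1) ^ 2) t) atTop (𝓝[≥] t) := by
  obtain ⟨K, hK⟩ := exists_nat_ge ((t : ℝ≥0) - η)
  have key : ∀ k, K ≤ k → (t : ℝ≥0) ≤ roundUp η (1 / (k + 1 : ℕ)) ((k + 1) ^ 2) t ∧
      (roundUp η (1 / (k + 1 : ℕ)) ((k + 1) ^ 2) t : ℝ≥0) ≤ t + 1 / (k + 1 : ℕ) := by
    intro k hk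
    have hpos : (0 : ℝ≥0) < (k + 1 : ℕ) := by positivity
    set u := (t : ℝ≥0) - η with hu
    have ht : (t : ℝ≥0) = η + u := (add_tsub_cancel_of_le (Set.mem_Ici.1 t.2)).symm
    have hle : ⌈u / (1 / (k + 1 : ℕ))⌉₊ ≤ (k + 1) ^ 2 := by
      refine Nat.ceil_le.2 ?_
      rw [div_div_eq_mul_div, div_one]
      push_cast
      rw [sq]
      gcongr
      exact hK.trans (by exact_mod_cast hk.trans k.le_succ)
    have hr : (roundUp η (1 / (k + 1 : ℕ)) ((k + 1) ^ 2) t : ℝ≥0) =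
        η + ⌈u / (1 / (k + 1 : ℕ))⌉₊ * (1 / (k + 1 : ℕ)) := by
      simp only [roundUp, gridIdx, gridPt, ← hu, min_eq_left hle]
    have h1 := Nat.le_ceil (u / (1 / (k + 1 : ℕ)))
    have h2 := (Nat.ceil_lt_add_one (zero_le (a := u / (1 / (k + 1 : ℕ))))).le
    have hpos' : (0 : ℝ≥0) < 1 / (k + 1 : ℕ) := by positivity
    rw [hr, ht, add_assoc]
    refine ⟨add_le_add_right ((div_le_iff₀ hpos').1 h1) _, add_le_add_right ?_ _⟩
    refine (mul_le_mul_left h2 _).trans (le_of_eq ?_)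
    rw [add_mul, div_mul_cancel₀ _ hpos'.ne', one_mul]
  refine tendsto_nhdsWithin_iff.2 ⟨?_, (eventually_ge_atTop K).mono fun k hk => (key k hk).1⟩
  rw [tendsto_subtype_rng]
  have hlim : Tendsto (fun k : ℕ => (t : ℝ≥0) + 1 / (k + 1 : ℕ)) atTop (𝓝 (t : ℝ≥0)) := by
    have := (tendsto_one_div_add_atTop_nhds_zero_nat (𝕜 := ℝ≥0)).const_add (t : ℝ≥0)
    simpa using this
  exact tendsto_of_tendsto_of_tendsto_of_le_of_le' tendsto_const_nhds hlim
    ((eventually_ge_atTop K).mono fun k hk => (key k hk).1)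
    ((eventually_ge_atTop K).mono fun k hk => (key k hk).2)

variable {d : ℕ} {T : (n : ℕ) → (Fin n → Fin d → ℝ) → Set.Ici η}

/-- Time functions rounded up to a finite grid. -/
noncomputable def roundTime (h : ℝ≥0) (M : ℕ) (T : (n : ℕ) → (Fin n → Fin d → ℝ) → Set.Ici η) :
    (n : ℕ) → (Fin n → Fin d → ℝ) → Set.Ici η :=
  fun n β => roundUp η h M (T n β)

lemma IsTimeFunctions.roundTime (hT : IsTimeFunctions T) (h : ℝ≥0) (M : ℕ) :
    IsTimeFunctions (roundTime h M T) where
  measurable n := (measurable_roundUp η h M).comp (hT.measurable n)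
  antitone n β := roundUp_mono η h M (hT.antitone n β)

/-- Along a path that is locally constant to the right, rounding the times up to a fine grid does
not change the iterates. -/
lemma eventually_lnrPath_roundTime (c : Fin d → ℝ) {z : Set.Ici η → Fin d → ℝ}
    (hz : ∀ t, ∀ᶠ s in 𝓝[≥] t, z s = z t) (n : ℕ) :
    ∀ᶠ k : ℕ in atTop, lnrPath (roundTime (1 / (k + 1 : ℕ)) ((k + 1) ^ 2) T) c z n =
      lnrPath T c z n := by
  induction n using Nat.strong_induction_on with
  | _ n ih =>
    have h1 : ∀ᶠ k : ℕ in atTop, ∀ j : Fin n,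
        lnrPath (roundTime (1 / (k + 1 : ℕ)) ((k + 1) ^ 2) T) c z j = lnrPath T c z j :=
      eventually_all.2 fun j => ih j j.2
    filter_upwards [h1, (tendsto_roundUp (lnrTime T c z n)).eventually (hz (lnrTime T c z n))]
      with k hk1 hk2
    rw [lnrPath_eq, lnrPath_eq, ← hk2, lnrTime, lnrTime]
    simp_rw [hk1]
    rfl

lemma eventually_lnrTime_roundTime (c : Fin d → ℝ) {z : Set.Ici η → Fin d → ℝ}
    (hz : ∀ t, ∀ᶠ s in 𝓝[≥] t, z s = z t) (n : ℕ) :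
    ∀ᶠ k : ℕ in atTop, lnrTime (roundTime (1 / (k + 1 : ℕ)) ((k + 1) ^ 2) T) c z n =
      roundUp η (1 / (k + 1 : ℕ)) ((k + 1) ^ 2) (lnrTime T c z n) := by
  have h1 : ∀ᶠ k : ℕ in atTop, ∀ j : Fin n,
      lnrPath (roundTime (1 / (k + 1 : ℕ)) ((k + 1) ^ 2) T) c z j = lnrPath T c z j :=
    eventually_all.2 fun j => eventually_lnrPath_roundTime c hz j
  filter_upwards [h1] with k hk
  rw [lnrTime, lnrTime]
  simp_rw [hk]
  rfl

/-- The iterates as a function of the values of the path at finitely many grid points. -/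
noncomputable def gridLnr (h : ℝ≥0) (M : ℕ) (T : (n : ℕ) → (Fin n → Fin d → ℝ) → Set.Ici η)
    (w : Fin (M + 1) → Fin d → ℝ) (n : ℕ) : Fin d → ℝ :=
  lnrPath T 0 (fun t => w (gridIdx η h M t)) n

lemma measurable_gridLnr (hT : IsTimeFunctions T) (h : ℝ≥0) (M n : ℕ) :
    Measurable fun w => gridLnr h M T w n := by
  induction n using Nat.strong_induction_on with
  | _ n ih =>
    have h1 : Measurable fun w => gridIdx η h M (T n fun j => gridLnr h M T w j) :=
      (measurable_gridIdx η h M).comp ((hT.measurable n).comp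
        (measurable_pi_lambda _ fun j => ih j j.2))
    have h2 : Measurable fun q : (Fin (M + 1) → Fin d → ℝ) × Fin (M + 1) => q.1 q.2 :=
      measurable_from_prod_countable_left fun j => measurable_pi_apply j
    have h3 : (fun w => gridLnr h M T w n) =
        fun w => w (gridIdx η h M (T n fun j => gridLnr h M T w j)) := by
      ext1 w
      rw [gridLnr, lnrPath_eq, zero_add]
      rfl
    rw [h3]
    exact h2.comp (measurable_id.prodMk h1)

end Rounding

/-! ### Comparison of the iterates under two shifts -/

section Shift

open Filter Topology

variable {Ω : Type*} [MeasurableSpace Ω] {P : Measure Ω} {d : ℕ} {η : ℝ≥0}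
  {Z : Set.Ici η → Ω → Fin d → ℝ} {T : (n : ℕ) → (Fin n → Fin d → ℝ) → Set.Ici η}

lemma lnrTime_roundTime (h : ℝ≥0) (M : ℕ) (c : Fin d → ℝ) (z : Set.Ici η → Fin d → ℝ) (n : ℕ) :
    ∃ j : Fin (M + 1), lnrTime (roundTime h M T) c z n = gridPt η h j :=
  ⟨_, rfl⟩

/-- If the time with index `n` is the grid point with index `k`, the iterates up to `n` are
functions of the noise path at the grid points from this one on; and conversely. -/
lemma lnr_eq_gridLnr (hT : IsTimeFunctions T) {h : ℝ≥0} (hh : 0 < h) {M : ℕ} (c : Fin d → ℝ)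
    (z : Set.Ici η → Fin d → ℝ) (n : ℕ) (k : Fin (M + 1))
    (hk : lnrTime (roundTime h M T) c z n = gridPt η h k ∨
      roundTime h M T n (fun j => gridLnr h M (roundTime h M T)
        (fun j => c + z (gridPt η h (max j k))) j) = gridPt η h k) :
    (∀ i ≤ n, lnrPath (roundTime h M T) c z i =
      gridLnr h M (roundTime h M T) (fun j => c + z (gridPt η h (max j k))) i) ∧
    lnrTime (roundTime h M T) c z n = roundTime h M T n (fun j => gridLnr h M (roundTime h M T)
        (fun j => c + z (gridPt η h (max j k))) j) := by
  set T' := roundTime h M T with hT'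
  set z₁ : Set.Ici η → Fin d → ℝ := fun t => c + z t with hz₁
  set z₂ : Set.Ici η → Fin d → ℝ := fun t => c + z (gridPt η h (max (gridIdx η h M t) k)) with hz₂
  have hlt : lnrTime T' c z n = lnrTime T' 0 z₁ n := by
    rw [lnrTime, lnrTime]
    simp_rw [fun j : Fin n => lnrPath_eq_zero_add T' c z j]
    rfl
  -- The step path `z₂` matches `z₁` at grid points from `k` on but not necessarily in between;
  -- rounded time functions take no other values.
  have hagree : ∀ i β, gridPt η h k ≤ T' i β → z₁ (T' i β) = z₂ (T' i β) := by
    intro i β hle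
    simp only [hz₁, hz₂, hT', roundTime, roundUp, gridIdx_gridPt hh] at hle ⊢
    rw [max_eq_left ((gridPt_le_gridPt hh).1 hle)]
  have hk' : lnrTime T' 0 z₁ n = gridPt η h k ∨ lnrTime T' 0 z₂ n = gridPt η h k := by
    rcases hk with hk | hk
    · exact Or.inl (hlt ▸ hk)
    · exact Or.inr hk
  rw [hlt]
  simp_rw [lnrPath_eq_zero_add T' c z]
  rcases hk' with hk | hk
  · exact ⟨fun i hi => lnrPath_congr (hT.roundTime h M) 0 (hk ▸ hagree) hi,
      lnrTime_congr (hT.roundTime h M) 0 (hk ▸ hagree)⟩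
  -- When it is the frozen path that reaches grid point `k`, the same argument runs with the two
  -- paths exchanged.
  · have hagree' : ∀ i β, lnrTime T' 0 z₂ n ≤ T' i β → z₂ (T' i β) = z₁ (T' i β) := fun i β hle =>
      (hagree i β (hk ▸ hle)).symm
    exact ⟨fun i hi => (lnrPath_congr (hT.roundTime h M) 0 hagree' hi).symm,
      (lnrTime_congr (hT.roundTime h M) 0 hagree').symm⟩

lemma lnrPath_roundTime_eq_gridLnr (hT : IsTimeFunctions T) {h : ℝ≥0} (hh : 0 < h) {M : ℕ}
    (c : Fin d → ℝ) (z : Set.Ici η → Fin d → ℝ) (n : ℕ) :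
    lnrPath (roundTime h M T) c z n =
      gridLnr h M (roundTime h M T) (fun j => c + z (gridPt η h j)) n := by
  rw [lnrPath_eq_zero_add, gridLnr]
  refine lnrPath_congr (hT.roundTime h M) 0 (n := n) (fun i β _ => ?_) le_rfl
  simp only [roundTime, roundUp, gridIdx_gridPt hh]

lemma measurable_lnrPath_roundTime (hZ : IsLaplaceNoiseProcess P η Z) (hT : IsTimeFunctions T)
    {h : ℝ≥0} (hh : 0 < h) (M : ℕ) (c : Fin d → ℝ) (n : ℕ) :
    Measurable fun ω => lnrPath (roundTime h M T) c (fun t => Z t ω) n := by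
  simp_rw [lnrPath_roundTime_eq_gridLnr hT hh]
  have hw : Measurable fun ω (j : Fin (M + 1)) => c + Z (gridPt η h j) ω :=
    measurable_pi_lambda _ fun j => (hZ.measurable _).const_add c
  exact (measurable_gridLnr (hT.roundTime h M) h M n).comp hw

/-- A right-continuous integer-valued path is constant just to the right of each time. -/
lemma IsLaplaceNoise.eventually_eq {Z : Set.Ici η → Ω → ℝ} (hZ : IsLaplaceNoise P η Z) (ω : Ω)
    (t : Set.Ici η) : ∀ᶠ s in 𝓝[≥] t, Z s ω = Z t ω := by
  obtain ⟨N, ξ, hN, -, -, -, -, hZ⟩ := hZ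
  have h1 : ∀ᶠ s in 𝓝[≥] t, N s ω = N t ω := by
    have := hN.right_continuous ω t
    rw [ContinuousWithinAt, nhds_discrete, tendsto_pure] at this
    exact this
  filter_upwards [h1] with s hs
  rw [hZ, hZ, hs]

lemma IsLaplaceNoiseProcess.eventually_eq (hZ : IsLaplaceNoiseProcess P η Z) (ω : Ω)
    (t : Set.Ici η) : ∀ᶠ s in 𝓝[≥] t, Z s ω = Z t ω := by
  filter_upwards [eventually_all.2 fun i => (hZ.1 i).eventually_eq ω t] with s hs
  exact funext hs

/-- The process is evaluated at a random time; rounding reduces this to finitely many measurable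
values, followed by a pointwise limit. -/
lemma measurable_lnrPath (hZ : IsLaplaceNoiseProcess P η Z) (hT : IsTimeFunctions T)
    (c : Fin d → ℝ) (n : ℕ) : Measurable fun ω => lnrPath T c (fun t => Z t ω) n :=
  measurable_of_tendsto_metrizable
    (fun k => measurable_lnrPath_roundTime hZ hT (h := 1 / (k + 1 : ℕ)) (by positivity)
      ((k + 1) ^ 2) c n)
    (tendsto_pi_nhds.2 fun ω => tendsto_const_nhds.congr'
      ((eventually_lnrPath_roundTime c (hZ.eventually_eq ω) n).mono fun _ h => h.symm))

/-- On the event that the time of iterate `n` is grid point `k`, both the event and the iterates are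
functions of the shifted path frozen before `k`. Its laws under the two shifts are comparable with a
constant depending on `k`, and summing over `k` turns that constant into a function of the random
time. -/
lemma lintegral_lnrPath_roundTime_le [IsProbabilityMeasure P] (hη : 0 < η)
    (hZ : IsLaplaceNoiseProcess P η Z) (hT : IsTimeFunctions T) {h : ℝ≥0} (hh : 0 < h) (M : ℕ)
    (c c' : Fin d → ℝ) (n : ℕ) {G : (Fin (n + 1) → Fin d → ℝ) → ℝ≥0∞} (hG : Measurable G) :
    ∫⁻ ω, G (fun j => lnrPath (roundTime h M T) c (fun t => Z t ω) j) ∂P ≤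
      ∫⁻ ω, ENNReal.ofReal (Real.exp ((∑ i, |c i - c' i|) /
          (lnrTime (roundTime h M T) c' (fun t => Z t ω) n : ℝ≥0))) *
        G (fun j => lnrPath (roundTime h M T) c' (fun t => Z t ω) j) ∂P := by
  classical
  set T' := roundTime h M T with hT'
  set H : Fin (M + 1) → (Fin (M + 1) → Fin d → ℝ) → ℝ≥0∞ := fun k w =>
    if gridIdx η h M (T' n fun j => gridLnr h M T' w j) = k then
      G fun j => gridLnr h M T' w j else 0 with hH
  have hlnr : ∀ m : ℕ, Measurable fun w => fun j : Fin m => gridLnr h M T' w j := fun m =>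
    measurable_pi_lambda _ fun j => measurable_gridLnr (hT.roundTime h M) h M j
  have hHm : ∀ k, Measurable (H k) := fun k =>
    Measurable.ite (((measurable_gridIdx η h M).comp (((hT.roundTime h M).measurable n).comp
      (hlnr n))) (measurableSet_singleton k)) (hG.comp (hlnr (n + 1))) measurable_const
  have hVm : ∀ (c : Fin d → ℝ) (k : ℕ),
      Measurable fun ω (j : Fin (M + 1)) => c + Z (gridPt η h (max j k)) ω := fun c k =>
    measurable_pi_lambda _ fun j => (hZ.measurable _).const_add c
  have hHeq : ∀ (c : Fin d → ℝ) (k : Fin (M + 1)) ω,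
      H k (fun j => c + Z (gridPt η h (max j k)) ω) =
        if lnrTime T' c (fun t => Z t ω) n = gridPt η h k then
          G fun j => lnrPath T' c (fun t => Z t ω) j else 0 := by
    intro c k ω
    have hiff : ∀ β, gridIdx η h M (T' n β) = k ↔ T' n β = gridPt η h k := fun β => by
      constructor
      · intro hβ
        rw [← hβ]
        simp only [hT', roundTime, roundUp, gridIdx_gridPt hh]
      · intro hβ
        rw [hβ, gridIdx_gridPt hh]
    have hor := lnr_eq_gridLnr hT hh c (fun t => Z t ω) n k
    simp only [hH, hiff]
    by_cases h1 : lnrTime T' c (fun t => Z t ω) n = gridPt η h k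
    · obtain ⟨ha, hb⟩ := hor (Or.inl h1)
      rw [if_pos h1, if_pos (hb.symm.trans h1)]
      congr 1
      ext1 j
      exact (ha j (Nat.lt_succ_iff.1 j.2)).symm
    · rw [if_neg h1, if_neg]
      intro h2
      exact h1 ((hor (Or.inr h2)).2.trans h2)
  -- For each outcome a single `k` contributes. Weights `1` split the left side, and the comparison
  -- constants reassemble the right side.
  have hsum : ∀ (c : Fin d → ℝ) (C : Fin (M + 1) → ℝ≥0∞) (k : Fin (M + 1)) ω,
      lnrTime T' c (fun t => Z t ω) n = gridPt η h k →
      ∑ k, C k * H k (fun j => c + Z (gridPt η h (max j k)) ω) =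
        C k * G fun j => lnrPath T' c (fun t => Z t ω) j := by
    intro c C k ω hk
    simp_rw [hHeq]
    rw [Finset.sum_eq_single k, if_pos hk]
    · intro i _ hik
      rw [if_neg, mul_zero]
      intro hi
      exact hik (by rw [← gridIdx_gridPt (η := η) hh i, ← hi, hk, gridIdx_gridPt hh])
    · simp
  set C : Fin (M + 1) → ℝ≥0∞ := fun k =>
    ENNReal.ofReal (Real.exp ((∑ i, |c i - c' i|) / (gridPt η h k : ℝ≥0))) with hC
  calc ∫⁻ ω, G (fun j => lnrPath T' c (fun t => Z t ω) j) ∂P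
      = ∫⁻ ω, ∑ k : Fin (M + 1), H k (fun j => c + Z (gridPt η h (max j k)) ω) ∂P := by
        congr 1 with ω
        obtain ⟨k, hk⟩ := lnrTime_roundTime (T := T) h M c (fun t => Z t ω) n
        simpa using (hsum c (fun _ => 1) k ω hk).symm
    _ = ∑ k : Fin (M + 1), ∫⁻ w, H k w ∂(P.map fun ω (j : Fin (M + 1)) => c + Z (gridPt η h (max j k)) ω) := by
        rw [lintegral_finsetSum (f := fun (k : Fin (M + 1)) ω =>
          H k (fun j => c + Z (gridPt η h (max j k)) ω)) _ fun k _ => (hHm k).comp (hVm c k)]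
        simp_rw [lintegral_map (hHm _) (hVm c _)]
    _ ≤ ∑ k : Fin (M + 1), ∫⁻ w, H k w
          ∂(C k • P.map fun ω (j : Fin (M + 1)) => c' + Z (gridPt η h (max j k)) ω) :=
        Finset.sum_le_sum fun k _ => lintegral_mono' (hZ.map_const_add_le hη h k M c c') le_rfl
    _ = ∫⁻ ω, ∑ k : Fin (M + 1), C k * H k (fun j => c' + Z (gridPt η h (max j k)) ω) ∂P := by
        rw [lintegral_finsetSum (f := fun (k : Fin (M + 1)) ω =>
          C k * H k (fun j => c' + Z (gridPt η h (max j k)) ω)) _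
          fun k _ => ((hHm k).comp (hVm c' k)).const_mul (C k)]
        simp_rw [lintegral_smul_measure, lintegral_map (hHm _) (hVm c' _)]
        refine Finset.sum_congr rfl fun k _ => ?_
        exact (lintegral_const_mul _ ((hHm k).comp (hVm c' k))).symm
    _ = _ := by
        congr 1 with ω
        obtain ⟨k, hk⟩ := lnrTime_roundTime (T := T) h M c' (fun t => Z t ω) n
        rw [hsum c' C k ω hk, hk]

/-- The laws of the first iterates of two Laplace noise reduction mechanisms. -/
lemma measure_lnrPath_le [IsProbabilityMeasure P] (hη : 0 < η)
    (hZ : IsLaplaceNoiseProcess P η Z) (hT : IsTimeFunctions T) (c c' : Fin d → ℝ) (n : ℕ)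
    {A : Set (Fin (n + 1) → Fin d → ℝ)} (hA : MeasurableSet A) :
    P {ω | (fun j : Fin (n + 1) => lnrPath T c (fun t => Z t ω) j) ∈ A} ≤
      ∫⁻ ω in {ω | (fun j : Fin (n + 1) => lnrPath T c' (fun t => Z t ω) j) ∈ A},
        ENNReal.ofReal (Real.exp ((∑ i, |c i - c' i|) /
          (lnrTime T c' (fun t => Z t ω) n : ℝ≥0))) ∂P := by
  set K := ∑ i, |c i - c' i| with hK
  have hK0 : 0 ≤ K := Finset.sum_nonneg fun i _ => abs_nonneg _
  have hpos : ∀ t : Set.Ici η, (0 : ℝ) < (t : ℝ≥0) := fun t => NNReal.coe_pos.2 (hη.trans_le t.2)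
  set e : Set.Ici η → ℝ≥0∞ := fun t => ENNReal.ofReal (Real.exp (K / (t : ℝ≥0))) with he
  have hec : Continuous e := ENNReal.continuous_ofReal.comp (Real.continuous_exp.comp
    (continuous_const.div (NNReal.continuous_coe.comp continuous_subtype_val)
      fun t => (hpos t).ne'))
  have heb : ∀ t, e t ≤ ENNReal.ofReal (Real.exp (K / η)) := fun t => by
    refine ENNReal.ofReal_le_ofReal (Real.exp_le_exp.2 ?_)
    exact div_le_div_of_nonneg_left hK0 (by exact_mod_cast hη) (NNReal.coe_le_coe.2 t.2)
  set G : (Fin (n + 1) → Fin d → ℝ) → ℝ≥0∞ := A.indicator 1 with hG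
  have hGm : Measurable G := measurable_one.indicator hA
  have hG1 : ∀ y, G y ≤ 1 := fun y => Set.indicator_le_self' (by simp) y
  have hym : ∀ (c : Fin d → ℝ), Measurable fun ω (j : Fin (n + 1)) =>
      lnrPath T c (fun t => Z t ω) j := fun c =>
    measurable_pi_lambda _ fun j => measurable_lnrPath hZ hT c j
  have hset : ∀ c : Fin d → ℝ, MeasurableSet
      {ω | (fun j : Fin (n + 1) => lnrPath T c (fun t => Z t ω) j) ∈ A} := fun c => hym c hA
  set R : ℕ → (n : ℕ) → (Fin n → Fin d → ℝ) → Set.Ici η := fun k =>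
    roundTime (1 / (k + 1 : ℕ)) ((k + 1) ^ 2) T with hR
  have hykm : ∀ (k : ℕ) (c : Fin d → ℝ) (m : ℕ), Measurable fun ω (j : Fin m) =>
      lnrPath (R k) c (fun t => Z t ω) j := fun k c m =>
    measurable_pi_lambda _ fun j => measurable_lnrPath_roundTime hZ hT (by positivity) _ c j
  -- Eventual equality, not mere convergence, lets the discontinuous indicator `G` pass to the
  -- limit; the exponential factor only needs continuity and its bound at `η`.
  have hev : ∀ (c : Fin d → ℝ) ω, ∀ᶠ k in atTop,
      (fun j : Fin (n + 1) => lnrPath (R k) c (fun t => Z t ω) j) =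
        fun j : Fin (n + 1) => lnrPath T c (fun t => Z t ω) j := fun c ω =>
    (eventually_all.2 fun j : Fin (n + 1) =>
      eventually_lnrPath_roundTime c (hZ.eventually_eq ω) j).mono fun k hk => funext hk
  have hL : Tendsto (fun k => ∫⁻ ω, G (fun j => lnrPath (R k) c (fun t => Z t ω) j) ∂P) atTop
      (𝓝 (∫⁻ ω, G (fun j => lnrPath T c (fun t => Z t ω) j) ∂P)) := by
    refine tendsto_lintegral_of_dominated_convergence (fun _ => 1)
      (fun k => hGm.comp (hykm k c _)) (fun k => Eventually.of_forall fun ω => hG1 _) (by simp)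
      (Eventually.of_forall fun ω => tendsto_const_nhds.congr' ?_)
    filter_upwards [hev c ω] with k hk
    rw [hk]
  have hRt : Tendsto (fun k => ∫⁻ ω, e (lnrTime (R k) c' (fun t => Z t ω) n) *
        G (fun j => lnrPath (R k) c' (fun t => Z t ω) j) ∂P) atTop
      (𝓝 (∫⁻ ω, e (lnrTime T c' (fun t => Z t ω) n) *
        G (fun j => lnrPath T c' (fun t => Z t ω) j) ∂P)) := by
    refine tendsto_lintegral_of_dominated_convergence (fun _ => ENNReal.ofReal (Real.exp (K / η)))
      (fun k => ?_) (fun k => Eventually.of_forall fun ω => ?_) (by simp)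
      (Eventually.of_forall fun ω => ?_)
    · exact (hec.measurable.comp (((hT.roundTime _ _).measurable n).comp (hykm k c' n))).mul
        (hGm.comp (hykm k c' _))
    · exact (mul_le_mul' (heb _) (hG1 _)).trans (mul_one _).le
    · have h1 : Tendsto (fun k => e (roundUp η (1 / (k + 1 : ℕ)) ((k + 1) ^ 2)
          (lnrTime T c' (fun t => Z t ω) n)) * G (fun j => lnrPath T c' (fun t => Z t ω) j)) atTop
          (𝓝 (e (lnrTime T c' (fun t => Z t ω) n) *
            G (fun j => lnrPath T c' (fun t => Z t ω) j))) :=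
        ENNReal.Tendsto.mul_const ((hec.tendsto _).comp
          ((tendsto_roundUp _).mono_right nhdsWithin_le_nhds))
          (Or.inr (ne_top_of_le_ne_top ENNReal.one_ne_top (hG1 _)))
      refine h1.congr' ?_
      filter_upwards [hev c' ω, eventually_lnrTime_roundTime c' (hZ.eventually_eq ω) n]
        with k hk1 hk2
      rw [hk1, hk2]
  have hle := le_of_tendsto_of_tendsto' hL hRt fun k =>
    lintegral_lnrPath_roundTime_le hη hZ hT (by positivity) _ c c' n hGm
  calc _ = ∫⁻ ω, G (fun j => lnrPath T c (fun t => Z t ω) j) ∂P := by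
        rw [← lintegral_indicator_one (hset c)]
        rfl
    _ ≤ _ := hle
    _ = _ := by
        rw [← lintegral_indicator (hset c')]
        congr 1 with ω
        simp only [hG, Set.indicator, Set.mem_ofPred_eq, Pi.one_apply, mul_ite, mul_one, mul_zero]
        rfl

end Shift

/-! ### Absolute continuity of laws of infinite sequences -/

section Sequences

open Filter Topology symmDiff

variable {E : Type*} [MeasurableSpace E]

/-- If the laws of the initial segments of two random sequences have a bounded ratio, the laws of the
sequences are absolutely continuous. -/
lemma absolutelyContinuous_of_initial_le {μ ν : Measure (ℕ → E)} [IsFiniteMeasure μ]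
    [IsFiniteMeasure ν] {C : ℝ≥0∞} (hC : C ≠ ∞)
    (h : ∀ (n : ℕ) (A : Set (Fin (n + 1) → E)), MeasurableSet A →
      μ {y | (fun j : Fin (n + 1) => y j) ∈ A} ≤ C * ν {y | (fun j : Fin (n + 1) => y j) ∈ A}) :
    μ ≪ ν := by
  refine Measure.AbsolutelyContinuous.mk fun D hD hν => ?_
  -- Approximating in `μ + ν` makes one cylinder close to `D` for both measures at once.
  have hdense := Measure.MeasureDense.of_generateFrom_isSetAlgebra_finite (μ + ν)
    (isSetAlgebra_measurableCylinders (α := fun _ : ℕ => E)) generateFrom_measurableCylinders.symm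
  have hcyl : ∀ t ∈ measurableCylinders (fun _ : ℕ => E), μ t ≤ C * ν t := by
    intro t ht
    rw [measurableCylinders_nat] at ht
    simp only [Set.mem_iUnion, Set.mem_singleton_iff, exists_prop] at ht
    obtain ⟨n, S, hS, rfl⟩ := ht
    have hm : Measurable fun (y : Fin (n + 1) → E) (j : Finset.Iic n) =>
        y ⟨j, Nat.lt_succ_of_le (Finset.mem_Iic.1 j.2)⟩ := by fun_prop
    exact h n _ (hm hS)
  have key : ∀ ε : ℝ, 0 < ε → μ D ≤ (C + 1) * ENNReal.ofReal ε := by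
    intro ε hε
    obtain ⟨t, ht, hlt⟩ := hdense.approx D hD (measure_ne_top _ _) ε hε
    have h1 : μ (D ∆ t) ≤ ENNReal.ofReal ε := by
      refine le_trans ?_ hlt.le
      rw [Measure.add_apply]
      exact le_self_add
    have h2 : ν (D ∆ t) ≤ ENNReal.ofReal ε := by
      refine le_trans ?_ hlt.le
      rw [Measure.add_apply]
      exact le_add_self
    have hsub : D ⊆ t ∪ D ∆ t := fun y hy => by
      by_cases hyt : y ∈ t
      · exact Or.inl hyt
      · exact Or.inr (Or.inl ⟨hy, hyt⟩)
    have hsub' : t ⊆ D ∪ D ∆ t := fun y hy => by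
      by_cases hyt : y ∈ D
      · exact Or.inl hyt
      · exact Or.inr (Or.inr ⟨hy, hyt⟩)
    have h3 : ν t ≤ ENNReal.ofReal ε := by
      refine (measure_mono hsub').trans ((measure_union_le _ _).trans ?_)
      rw [hν, zero_add]
      exact h2
    calc μ D ≤ μ t + μ (D ∆ t) := (measure_mono hsub).trans (measure_union_le _ _)
      _ ≤ C * ENNReal.ofReal ε + ENNReal.ofReal ε :=
        add_le_add ((hcyl t ht).trans (mul_le_mul_right h3 C)) h1
      _ = (C + 1) * ENNReal.ofReal ε := by ring
  have hlim : Tendsto (fun n : ℕ => (C + 1) * ENNReal.ofReal (1 / ((n : ℝ) + 1))) atTop (𝓝 0) := by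
    have h1 := ENNReal.tendsto_ofReal (tendsto_one_div_add_atTop_nhds_zero_nat (𝕜 := ℝ))
    have h2 := ENNReal.Tendsto.const_mul (a := C + 1) h1
      (Or.inr (ENNReal.add_ne_top.2 ⟨hC, ENNReal.one_ne_top⟩))
    simpa using h2
  exact le_antisymm (ge_of_tendsto' hlim fun n => key _ (by positivity)) zero_le

end Sequences

/-! ### Stopped sequences and the privacy loss -/

section Stopped

variable {Ω 𝒳 𝒴 : Type*} {M : 𝒳 → Ω → ℕ → 𝒴}
  {N : (ℕ → 𝒴) → ℕ}

lemma measurable_of_sigma {α β : Type*} {γ : α → Type*} [∀ a, MeasurableSpace (γ a)]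
    [MeasurableSpace β] {g : (Σ a, γ a) → β} (hg : ∀ a, Measurable fun y => g ⟨a, y⟩) :
    Measurable g := fun _ hs => MeasurableSpace.measurableSet_iInf.2 fun a => hg a hs

lemma measurable_sigmaMk {α : Type*} {γ : α → Type*} [∀ a, MeasurableSpace (γ a)] (a : α) :
    Measurable (Sigma.mk a : γ a → Σ a, γ a) := fun _ hs =>
  MeasurableSpace.measurableSet_iInf.1 hs a

lemma stopped_eq {x : 𝒳} {ω : Ω} {n : ℕ} (h : N (M x ω) = n) :
    stopped M N x ω = ⟨n, fun j => M x ω j⟩ := by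
  subst h; rfl

lemma preimage_stopped (x : 𝒳) (S : Set (Σ n : ℕ, Fin (n + 1) → 𝒴)) :
    stopped M N x ⁻¹' S = ⋃ n, {ω | N (M x ω) = n ∧
      (fun j : Fin (n + 1) => M x ω j) ∈ Sigma.mk n ⁻¹' S} := by
  ext ω
  simp only [Set.mem_preimage, Set.mem_iUnion, Set.mem_ofPred_eq]
  constructor
  · exact fun h => ⟨_, rfl, h⟩
  · rintro ⟨n, hn, h⟩
    rwa [stopped_eq hn]

variable [MeasurableSpace 𝒴]

/-- The event that a stopping function stops at `n` is determined by the iterates up to `n`. -/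
lemma IsStoppingFunction.exists_eq (hN : IsStoppingFunction M N) (x : 𝒳) (n : ℕ) :
    ∃ B : Set (Fin (n + 1) → 𝒴), MeasurableSet B ∧
      ∀ ω, N (M x ω) = n ↔ (fun j : Fin (n + 1) => M x ω j) ∈ B := by
  have hle : ∀ m ≤ n, MeasurableSet[MeasurableSpace.comap
      (fun ω (j : Fin (n + 1)) => M x ω j) inferInstance] {ω | N (M x ω) ≤ m} := by
    intro m hm
    refine (iSup₂_le fun i hi => ?_ : (⨆ i ≤ m, MeasurableSpace.comap (fun ω => M x ω i)
      inferInstance) ≤ _) _ (hN.2 x m)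
    rintro _ ⟨s, hs, rfl⟩
    have hp : Measurable fun y : Fin (n + 1) → 𝒴 => y ⟨i, by omega⟩ := measurable_pi_apply _
    exact ⟨_, hp hs, rfl⟩
  have heq : MeasurableSet[MeasurableSpace.comap
      (fun ω (j : Fin (n + 1)) => M x ω j) inferInstance] {ω | N (M x ω) = n} := by
    rcases n with _ | n
    · simpa using hle 0 le_rfl
    · have : {ω | N (M x ω) = n + 1} = {ω | N (M x ω) ≤ n + 1} \ {ω | N (M x ω) ≤ n} := by
        ext ω; simp only [Set.mem_sdiff, Set.mem_ofPred_eq]; omega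
      rw [this]
      exact MeasurableSet.diff (hle _ le_rfl) (hle _ n.le_succ)
  obtain ⟨B, hB, hBeq⟩ := heq
  exact ⟨B, hB, fun ω => (Set.ext_iff.1 hBeq ω).symm⟩

variable [MeasurableSpace Ω]

lemma measurableSet_stopped (hN : Measurable N) {x : 𝒳} (hM : Measurable (M x)) (n : ℕ)
    {A : Set (Fin (n + 1) → 𝒴)} (hA : MeasurableSet A) :
    MeasurableSet {ω | N (M x ω) = n ∧ (fun j : Fin (n + 1) => M x ω j) ∈ A} := by
  have h1 : Measurable fun ω => fun j : Fin (n + 1) => M x ω j :=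
    measurable_pi_lambda _ fun j => measurable_pi_iff.1 hM j
  exact ((hN.comp hM) (measurableSet_singleton n)).inter (h1 hA)

lemma measurable_stopped (hN : Measurable N) {x : 𝒳} (hM : Measurable (M x)) :
    Measurable (stopped M N x) := fun S hS => by
  rw [preimage_stopped]
  exact MeasurableSet.iUnion fun n => measurableSet_stopped hN hM n (measurable_sigmaMk n hS)

/-- An inequality between integrals over all measurable sets is an almost everywhere inequality `p ≤
q * exp E` between densities. Where `q` vanishes so does `p`, hence the value `⊤` does not occur
there. -/
lemma privacyLoss_ae_le {μ ν : Measure 𝒴} [IsFiniteMeasure μ] [IsFiniteMeasure ν] {E : 𝒴 → ℝ≥0}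
    (hE : Measurable E) (hle : ∀ S, MeasurableSet S →
      μ S ≤ ∫⁻ y in S, ENNReal.ofReal (Real.exp (E y)) ∂ν) :
    ∀ᵐ y ∂μ, privacyLoss μ ν y ≤ ((E y : ℝ) : EReal) := by
  have hμ : μ ≪ μ + ν := Measure.AbsolutelyContinuous.rfl.add_right ν
  have hν : ν ≪ μ + ν := by rw [add_comm]; exact Measure.AbsolutelyContinuous.rfl.add_right μ
  have hem : Measurable fun y => ENNReal.ofReal (Real.exp (E y)) := by fun_prop
  refine hμ.ae_le ?_
  have key : μ.rnDeriv (μ + ν) ≤ᵐ[μ + ν]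
      ν.rnDeriv (μ + ν) * fun y => ENNReal.ofReal (Real.exp (E y)) := by
    refine ae_le_of_forall_setLIntegral_le_of_sigmaFinite (Measure.measurable_rnDeriv _ _)
      fun S hS _ => ?_
    rw [Measure.setLIntegral_rnDeriv hμ, ← setLIntegral_withDensity_eq_setLIntegral_mul _
      (Measure.measurable_rnDeriv _ _) hem hS, Measure.withDensity_rnDeriv_eq _ _ hν]
    exact hle S hS
  filter_upwards [key] with y hy
  rw [privacyLoss, ← EReal.log_exp ((E y : ℝ) : EReal), EReal.exp_coe]
  exact ENNReal.log_le_log (ENNReal.div_le_of_le_mul' hy)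

end Stopped

/-! ### The stopped mechanism -/

section Mechanism

variable {Ω 𝒳 : Type*} [MeasurableSpace Ω] {P : Measure Ω} {d : ℕ} {η : ℝ≥0}
  {Z : Set.Ici η → Ω → Fin d → ℝ} {T : (n : ℕ) → (Fin n → Fin d → ℝ) → Set.Ici η}

lemma measurable_LNR (hZ : IsLaplaceNoiseProcess P η Z) (hT : IsTimeFunctions T)
    (f : 𝒳 → Fin d → ℝ) (x : 𝒳) : Measurable (LNR f T Z x) :=
  measurable_pi_lambda _ fun n => measurable_lnrPath hZ hT (f x) n

lemma measurable_timeRatio (hT : IsTimeFunctions T) (Δ : ℝ≥0) : Measurable (timeRatio Δ T) := by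
  refine measurable_of_sigma fun n => ?_
  have h1 : Measurable fun y : Fin (n + 1) → Fin d → ℝ => T n fun j => y j.castSucc :=
    (hT.measurable n).comp (by fun_prop)
  exact (measurable_subtype_coe.comp h1).const_div Δ

/-- The laws of the output sequences for two inputs are absolutely continuous. -/
lemma map_LNR_absolutelyContinuous [IsProbabilityMeasure P] (hη : 0 < η)
    (hZ : IsLaplaceNoiseProcess P η Z) (hT : IsTimeFunctions T) (f : 𝒳 → Fin d → ℝ) (x x' : 𝒳) :
    P.map (LNR f T Z x) ≪ P.map (LNR f T Z x') := by
  have := Measure.isProbabilityMeasure_map (μ := P) (measurable_LNR hZ hT f x).aemeasurable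
  have := Measure.isProbabilityMeasure_map (μ := P) (measurable_LNR hZ hT f x').aemeasurable
  refine absolutelyContinuous_of_initial_le
    (C := ENNReal.ofReal (Real.exp ((∑ i, |f x i - f x' i|) / η))) ENNReal.ofReal_ne_top
    fun n A hA => ?_
  have hm : Measurable fun (y : ℕ → Fin d → ℝ) (j : Fin (n + 1)) => y j := by fun_prop
  have hA' : MeasurableSet {y : ℕ → Fin d → ℝ | (fun j : Fin (n + 1) => y j) ∈ A} := hm hA
  rw [Measure.map_apply (measurable_LNR hZ hT f x) hA',
    Measure.map_apply (measurable_LNR hZ hT f x') hA']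
  refine (measure_lnrPath_le hη hZ hT (f x) (f x') n hA).trans ?_
  refine (lintegral_mono fun ω => ?_).trans (setLIntegral_const _ _).le
  refine ENNReal.ofReal_le_ofReal (Real.exp_le_exp.2 ?_)
  exact div_le_div_of_nonneg_left (Finset.sum_nonneg fun i _ => abs_nonneg _)
    (by exact_mod_cast hη) (NNReal.coe_le_coe.2 (Subtype.property _))

lemma map_stopped_le [IsProbabilityMeasure P] (hη : 0 < η) (hZ : IsLaplaceNoiseProcess P η Z)
    (hT : IsTimeFunctions T) {f : 𝒳 → Fin d → ℝ} {N : (ℕ → Fin d → ℝ) → ℕ}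
    (hN : IsStoppingFunction (LNR f T Z) N) {x x' : 𝒳} {Δ : ℝ≥0}
    (hΔ : ∑ i, |f x i - f x' i| ≤ Δ) {S : Set (Σ n : ℕ, Fin (n + 1) → Fin d → ℝ)}
    (hS : MeasurableSet S) :
    P.map (stopped (LNR f T Z) N x) S ≤ ∫⁻ y in S, ENNReal.ofReal (Real.exp (timeRatio Δ T y))
      ∂(P.map (stopped (LNR f T Z) N x')) := by
  have hM := measurable_LNR hZ hT f
  have hem : Measurable fun y => ENNReal.ofReal (Real.exp (timeRatio Δ T y)) := by
    have := measurable_timeRatio hT Δ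
    fun_prop
  rw [Measure.map_apply (measurable_stopped hN.1 (hM x)) hS,
    setLIntegral_map hS hem (measurable_stopped hN.1 (hM x')), preimage_stopped, preimage_stopped,
    lintegral_iUnion (fun n => measurableSet_stopped hN.1 (hM x') n (measurable_sigmaMk n hS))]
  swap
  · intro m n hmn
    exact Set.disjoint_left.2 fun ω h1 h2 => hmn (h1.1.symm.trans h2.1)
  refine (measure_iUnion_le _).trans (ENNReal.tsum_le_tsum fun n => ?_)
  obtain ⟨B, hB, hBx⟩ := hN.exists_eq x n
  have hr : Measurable fun (y : ℕ → Fin d → ℝ) (j : Fin (n + 1)) => y j := by fun_prop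
  -- `B` describes the event `N = n` only along outputs for `x`. The equivalence holds almost surely
  -- under the law for `x`, and that law dominates the one for `x'`.
  have hBx' : ∀ᵐ ω ∂P, N (LNR f T Z x' ω) = n ↔
      (fun j : Fin (n + 1) => LNR f T Z x' ω j) ∈ B := by
    refine ae_of_ae_map (hM x').aemeasurable
      (p := fun y => N y = n ↔ (fun j : Fin (n + 1) => y j) ∈ B) ?_
    refine (map_LNR_absolutelyContinuous hη hZ hT f x' x).ae_le
      ((ae_map_iff (hM x).aemeasurable ?_).2 (Filter.Eventually.of_forall hBx))
    have h1 : Measurable fun y => N y = n := hN.1.eq measurable_const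
    have h2 : Measurable fun y : ℕ → Fin d → ℝ => (fun j : Fin (n + 1) => y j) ∈ B :=
      measurableSet_setOfPred.1 (hr hB)
    exact measurableSet_setOfPred.2 (h1.iff h2)
  set Sn : Set (Fin (n + 1) → Fin d → ℝ) :=
    (fun y => (⟨n, y⟩ : Σ n : ℕ, Fin (n + 1) → Fin d → ℝ)) ⁻¹' S
  have hSn : MeasurableSet Sn := measurable_sigmaMk n hS
  calc P {ω | N (LNR f T Z x ω) = n ∧ (fun j : Fin (n + 1) => LNR f T Z x ω j) ∈ Sn}
      = P {ω | (fun j : Fin (n + 1) => lnrPath T (f x) (fun t => Z t ω) j) ∈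
          B ∩ Sn} := by
        congr 1
        ext ω
        exact and_congr_left fun _ => hBx ω
    _ ≤ _ := measure_lnrPath_le hη hZ hT (f x) (f x') n (hB.inter hSn)
    _ = ∫⁻ ω in {ω | N (LNR f T Z x' ω) = n ∧
          (fun j : Fin (n + 1) => LNR f T Z x' ω j) ∈ Sn},
          ENNReal.ofReal (Real.exp ((∑ i, |f x i - f x' i|) /
            (lnrTime T (f x') (fun t => Z t ω) n : ℝ≥0))) ∂P := by
        refine setLIntegral_congr ?_
        filter_upwards [hBx'] with ω hω
        exact propext (and_congr_left fun _ => hω.symm)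
    _ ≤ _ := by
        refine setLIntegral_mono' (measurableSet_stopped hN.1 (hM x') n hSn) fun ω hω => ?_
        rw [stopped_eq hω.1]
        refine ENNReal.ofReal_le_ofReal (Real.exp_le_exp.2 ?_)
        rw [timeRatio, NNReal.coe_div]
        exact div_le_div_of_nonneg_right hΔ (NNReal.coe_nonneg _)

lemma sum_abs_sub_le_of_l1Sensitivity {Adj : 𝒳 → 𝒳 → Prop} {f : 𝒳 → Fin d → ℝ} {Δ : ℝ≥0}
    (hf : l1Sensitivity Adj f = Δ) {x x' : 𝒳} (h : Adj x x') : ∑ i, |f x i - f x' i| ≤ Δ := by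
  have h1 : ENNReal.ofReal (∑ i, |f x i - f x' i|) ≤ Δ :=
    hf ▸ le_iSup₂_of_le x x' (le_iSup_of_le h le_rfl)
  exact (ENNReal.ofReal_le_iff_le_toReal ENNReal.coe_ne_top).1 h1

end Mechanism

end NoiseReduction

theorem proposition4p1 {Ω 𝒳 : Type*} [MeasurableSpace Ω] (P : Measure Ω) [IsProbabilityMeasure P]
    (d : ℕ) (η : ℝ≥0) (hη : 0 < η)
    (Z : Set.Ici η → Ω → Fin d → ℝ) (hZ : IsLaplaceNoiseProcess P η Z)
    (Adj : 𝒳 → 𝒳 → Prop) (f : 𝒳 → Fin d → ℝ)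
    (Δ₁ : ℝ≥0) (hf : l1Sensitivity Adj f = Δ₁)
    (T : (n : ℕ) → (Fin n → Fin d → ℝ) → Set.Ici η) (hT : IsTimeFunctions T)
    (N : (ℕ → Fin d → ℝ) → ℕ) (hN : IsStoppingFunction (LNR f T Z) N) :
    IsExPostPrivate P Adj (stopped (LNR f T Z) N) (timeRatio Δ₁ T) 0 := by
  have hA : ∀ x, Measurable (stopped (LNR f T Z) N x) := fun x =>
    measurable_stopped hN.1 (measurable_LNR hZ hT f x)
  refine ⟨fun x => (hA x).aemeasurable, fun x x' hxx' => le_of_eq ?_⟩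
  have := Measure.isProbabilityMeasure_map (μ := P) (hA x).aemeasurable
  have := Measure.isProbabilityMeasure_map (μ := P) (hA x').aemeasurable
  have h := ae_of_ae_map (hA x).aemeasurable (privacyLoss_ae_le (measurable_timeRatio hT Δ₁)
    fun S hS => map_stopped_le hη hZ hT hN (sum_abs_sub_le_of_l1Sensitivity hf hxx') hS)
  simpa only [not_le] using ae_iff.1 h
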